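/- Let $X$ be a real random variable with $E(X)=0$ whose distribution is in the domain of attraction of the normal law; that is, if $X_1,X_2,\dots$ are independent copies of $X$, there are real constants $a_n$ and $c_n>0$ such that $(X_1+\dots+X_n-a_n)/c_n$ converges in distribution to the standard normal law. Let $\Phi$ and $\phi$ be the standard normal distribution function and density. Put $b_n=\sup\{x : n x^{-2}E[X^2 I(|X|\le x)]\ge 1\}$ (a finite positive number for all large $n$), $$L_n(x)=n\,E\big(\Phi[x\{1+(X/b_n)^2\}^{1/2}-(X/b_n)]-\Phi(x)\big),$$ $$\delta_n=nP(|X|>b_n)+nb_n^{-1}|E\{XI(|X|\le b_n)\}|+nb_n^{-3}|E\{X^3I(|X|\le b_n)\}|+nb_n^{-4}E\{X^4I(|X|\le b_n)\}.$$ Write $u_n\asymp v_n$ if $0<\liminf_{n\to\infty}u_n/v_n\le\limsup_{n\to\infty}u_n/v_n<\infty$. Then, as $n\to\infty$: 1. $\delta_n\to0$. 2. $\sup_{-\infty<x<\infty}|L_n(x)|\asymp\delta_n$. 3. For all real $x_0>\sqrt3$ and $x_1\ne\pm x_0$, $\ \sup_{x\in\{-x_0,x_0,x_1\}}|L_n(x)|\asymp\delta_n$.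 4. If moreover $E|X|^3<\infty$, $E(X^2)=1$ and $E(X^3)=\gamma$, then $$\sup_{-\infty<x<\infty}\Big|n^{1/2}L_n(x)-\tfrac16\gamma(2x^2+1)\phi(x)\Big|\to0 .$$ -/

import Mathlib

open MeasureTheory ProbabilityTheory Filter Topology

noncomputable section

namespace StudentT

/-- The standard normal distribution function `Φ`. -/
def normalCDF (x : ℝ) : ℝ := cdf (gaussianReal 0 1) x

/-- The standard normal density `φ`. -/
def normalPDF (x : ℝ) : ℝ := gaussianPDFReal 0 1 x

/-- A probability distribution `μ` on the line is in the domain of attraction of the normal law: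
for independent variables `X₁, X₂, …` with distribution `μ` there are centring constants `a n` and
scaling constants `c n > 0` such that `(X₁ + ⋯ + Xₙ - a n) / c n` converges in distribution to the
standard normal law. The first `n` variables are realised as the coordinates of `ℝⁿ` under the
product measure `μ ⊗ ⋯ ⊗ μ`. -/
def InNormalDomainOfAttraction (μ : Measure ℝ) [IsProbabilityMeasure μ] : Prop :=
  ∃ a c : ℕ → ℝ, (∀ n, 0 < c n) ∧
    TendstoInDistribution (fun (n : ℕ) (y : Fin n → ℝ) => ((∑ i, y i) - a n) / c n) atTop
      (id : ℝ → ℝ) (fun n : ℕ => Measure.pi (fun _ : Fin n => μ)) (gaussianReal 0 1)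

variable {Ω : Type*} [MeasurableSpace Ω]

/-- The truncated moment `E[X ^ k I(|X| ≤ x)]`. -/
def truncMoment (P : Measure Ω) (X : Ω → ℝ) (k : ℕ) (x : ℝ) : ℝ :=
  ∫ ω, {ω | |X ω| ≤ x}.indicator (fun ω => X ω ^ k) ω ∂P

/-- `b_n = sup {x : n x⁻² E[X² I(|X| ≤ x)] ≥ 1}`. The set is always bounded above, and it is
nonempty for all large `n` unless `X = 0` almost surely. -/
def scale (P : Measure Ω) (X : Ω → ℝ) (n : ℕ) : ℝ :=
  sSup {x : ℝ | 1 ≤ (n : ℝ) * (x ^ 2)⁻¹ * truncMoment P X 2 x}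

/-- `L_n(x) = n E(Φ[x {1 + (X / b_n)²}^{1/2} - X / b_n] - Φ(x))`. -/
def leadingTerm (P : Measure Ω) (X : Ω → ℝ) (n : ℕ) (x : ℝ) : ℝ :=
  (n : ℝ) * ∫ ω, (normalCDF (x * √(1 + (X ω / scale P X n) ^ 2) - X ω / scale P X n)
    - normalCDF x) ∂P

/-- `δ_n = n P(|X| > b_n) + n b_n⁻¹ |E{X I(|X| ≤ b_n)}| + n b_n⁻³ |E{X³ I(|X| ≤ b_n)}|
+ n b_n⁻⁴ E{X⁴ I(|X| ≤ b_n)}`. -/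
def rate (P : Measure Ω) (X : Ω → ℝ) (n : ℕ) : ℝ :=
  (n : ℝ) * P.real {ω | scale P X n < |X ω|}
    + (n : ℝ) * (scale P X n)⁻¹ * |truncMoment P X 1 (scale P X n)|
    + (n : ℝ) * (scale P X n ^ 3)⁻¹ * |truncMoment P X 3 (scale P X n)|
    + (n : ℝ) * (scale P X n ^ 4)⁻¹ * truncMoment P X 4 (scale P X n)

/-- `sup_{x ∈ S} |L_n(x)|`; the values are bounded by `n`, see `abs_leadingTerm_le`. -/
def supLeadingTerm (P : Measure Ω) (X : Ω → ℝ) (n : ℕ) (S : Set ℝ) : ℝ :=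
  sSup ((fun x => |leadingTerm P X n x|) '' S)

/-- `u_n ≍ v_n`, that is, `0 < liminf u_n / v_n ≤ limsup u_n / v_n < ∞`, with the limits taken in
the extended reals (the middle inequality is automatic). As `u / 0 = 0` here, the first inequality
contains the claim that `v_n ≠ 0` for all large `n`. -/
def SameOrder (u v : ℕ → ℝ) : Prop :=
  0 < liminf (fun n => ((u n / v n : ℝ) : EReal)) atTop ∧
    limsup (fun n => ((u n / v n : ℝ) : EReal)) atTop < ⊤

/-- The suprema of `|L_n|` are suprema of bounded sets. -/
theorem abs_leadingTerm_le (P : Measure Ω) [IsProbabilityMeasure P] (X : Ω → ℝ) (n : ℕ) (x : ℝ) :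
    |leadingTerm P X n x| ≤ n := by
  have h : ‖∫ ω, (normalCDF (x * √(1 + (X ω / scale P X n) ^ 2) - X ω / scale P X n)
      - normalCDF x) ∂P‖ ≤ 1 * P.real Set.univ := by
    refine norm_integral_le_of_norm_le_const (Eventually.of_forall fun ω => ?_)
    rw [Real.norm_eq_abs, abs_le]
    have h0 := fun y => cdf_nonneg (gaussianReal 0 1) y
    have h1 := fun y => cdf_le_one (gaussianReal 0 1) y
    unfold normalCDF
    constructor
    · linarith [h0 (x * √(1 + (X ω / scale P X n) ^ 2) - X ω / scale P X n), h1 x]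
    · linarith [h1 (x * √(1 + (X ω / scale P X n) ^ 2) - X ω / scale P X n), h0 x]
  rw [probReal_univ, mul_one, Real.norm_eq_abs] at h
  unfold leadingTerm
  rw [abs_mul, Nat.abs_cast]
  exact mul_le_of_le_one_right (Nat.cast_nonneg n) h

end StudentT

end

/-!
The proof separates a deterministic comparison from one probabilistic input.

*Comparison.* Write `g(x, u) = Φ(x √(1 + u²) - u) - Φ(x)`, so that `L_n(x) = n E g(x, X / b_n)`. The
Taylor expansion of `g(x, ·)` at `0` has no quadratic term,
`g(x, u) = -φ(x) u + φ(x) (2 x² + 1) u³ / 6 + O(u⁴)` for `|u| ≤ 1`, uniformly in `x`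
(`abs_cdfShift_sub_cubic_le`), and `|g| ≤ 1` for the other `u`. Hence `L_n(x)` is a combination of
the first and third truncated moments, up to a multiple of the remaining two terms of `δ_n`
(`exists_abs_integral_cdfShift_le`), which gives the upper bound `sup |L_n| ≤ C δ_n`. For the lower
bound, `g(x, u) - g(-x, u)` is an even function of `u` whose fourth-order coefficient is a positive
multiple of `x (x² - 3)`; for `x > √3` it is increasing in `u > 0` and at least `c min(1, u⁴)`
(`exists_le_cdfShift_sub_neg`). So the values of `L_n` at `±x₀` bound the first and last terms of
`δ_n`, and then the expansions at `x₀` and `x₁` form a linear system with determinant proportional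
to `x₀² - x₁² ≠ 0` for the two middle terms (`exists_normalizedRate_le`). With a finite third absolute
moment the same expansion, multiplied by `n^{3/2}`, gives the uniform limit.

*Tails.* That `δ_n → 0` rests on `x² P(|X| > x) = o(E[X² I(|X| ≤ x)])`, the necessity half of the
classical criterion for attraction to the normal law (`InNormalDomainOfAttraction.tailNegligible`).
Let `v(t) = E(1 - cos tX)`. Because `E X = 0`, the imaginary part of the characteristic function is
`o(t)`, so the convergence of its modulus gives `n v(t / c_n) → t² / 2`. As
`(1 - cos θ)² = 2 (1 - cos θ) - (1 - cos 2θ) / 2`, it follows that `n E(1 - cos(tX / c_n))² → 0`, and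
averaging over `t` yields `n P(|X| > λ c_n) → 0`, while `n c_n⁻² E[X² I(|X| ≤ λ c_n)]` stays bounded
above and below and `c_{n+1} / c_n` stays bounded. The bounds for the other truncated moments follow
by truncating at a second level and by summing over dyadic blocks.
-/

open MeasureTheory ProbabilityTheory Filter Topology

noncomputable section

namespace StudentT

/-! ### The normal distribution function -/

theorem normalPDF_eq (x : ℝ) : normalPDF x = (√(2 * Real.pi))⁻¹ * Real.exp (-x ^ 2 / 2) := by
  simp [normalPDF, gaussianPDFReal]

theorem normalPDF_pos (x : ℝ) : 0 < normalPDF x :=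
  gaussianPDFReal_pos 0 1 x one_ne_zero

theorem normalPDF_neg (x : ℝ) : normalPDF (-x) = normalPDF x := by
  simp [normalPDF_eq]

theorem continuous_normalPDF : Continuous normalPDF := by
  have : normalPDF = fun x => (√(2 * Real.pi))⁻¹ * Real.exp (-x ^ 2 / 2) := funext normalPDF_eq
  rw [this]; fun_prop

theorem normalPDF_le (x : ℝ) : normalPDF x ≤ Real.exp (-x ^ 2 / 2) := by
  rw [normalPDF_eq]
  have h : (1 : ℝ) ≤ √(2 * Real.pi) := by
    rw [Real.one_le_sqrt]; linarith [Real.pi_gt_three]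
  exact mul_le_of_le_one_left (Real.exp_nonneg _) (inv_le_one_of_one_le₀ h)

theorem hasDerivAt_normalCDF (x : ℝ) : HasDerivAt normalCDF (normalPDF x) x := by
  have hint : Integrable normalPDF := integrable_gaussianPDFReal 0 1
  have h : normalCDF = fun z => (∫ y in Set.Iic 0, normalPDF y) + ∫ y in (0 : ℝ)..z, normalPDF y := by
    funext z
    rw [← intervalIntegral.integral_Iic_sub_Iic hint.integrableOn hint.integrableOn]
    have : normalCDF z = ∫ y in Set.Iic z, normalPDF y := by
      rw [normalCDF, cdf_eq_real, measureReal_def,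
        gaussianReal_apply_eq_integral 0 one_ne_zero, ENNReal.toReal_ofReal]
      · rfl
      · exact integral_nonneg fun y => (normalPDF_pos y).le
    rw [this]; ring
  rw [h]
  exact (intervalIntegral.integral_hasDerivAt_right
    (continuous_normalPDF.intervalIntegrable 0 x)
    (continuous_normalPDF.stronglyMeasurableAtFilter volume (𝓝 x))
    continuous_normalPDF.continuousAt).const_add _

theorem continuous_normalCDF : Continuous normalCDF :=
  continuous_iff_continuousAt.2 fun x => (hasDerivAt_normalCDF x).continuousAt

theorem normalCDF_neg (x : ℝ) : normalCDF (-x) = 2 * normalCDF 0 - normalCDF x := by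
  have hd : ∀ z, HasDerivAt (fun z => normalCDF z + normalCDF (-z)) 0 z := by
    intro z
    have h1 := (hasDerivAt_normalCDF (-z)).comp z (hasDerivAt_neg z)
    have h2 := (hasDerivAt_normalCDF z).add h1
    convert! h2 using 1
    rw [normalPDF_neg]; ring
  have h := is_const_of_deriv_eq_zero (fun z => (hd z).differentiableAt)
    (fun z => (hd z).deriv) x 0
  simp only [neg_zero] at h
  linarith

/-! ### The self-normalising transformation of the normal distribution function -/

/-- The integrand `Φ(x √(1 + u²) - u) - Φ(x)` of the leading term, as a function of the
normalised variable `u = X / b_n`. -/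
def cdfShift (x u : ℝ) : ℝ := normalCDF (x * √(1 + u ^ 2) - u) - normalCDF x

theorem cdfShift_zero (x : ℝ) : cdfShift x 0 = 0 := by simp [cdfShift]

theorem continuous_cdfShift (x : ℝ) : Continuous (cdfShift x) := by
  unfold cdfShift
  have := continuous_normalCDF
  fun_prop

theorem abs_cdfShift_le_one (x u : ℝ) : |cdfShift x u| ≤ 1 := by
  have h0 := fun y => cdf_nonneg (gaussianReal 0 1) y
  have h1 := fun y => cdf_le_one (gaussianReal 0 1) y
  unfold cdfShift normalCDF
  rw [abs_le]
  constructor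
  · linarith [h0 (x * √(1 + u ^ 2) - u), h1 x]
  · linarith [h1 (x * √(1 + u ^ 2) - u), h0 x]

theorem one_le_sqrt_one_add_sq (u : ℝ) : 1 ≤ √(1 + u ^ 2) := by
  rw [Real.one_le_sqrt]; nlinarith [sq_nonneg u]

theorem hasDerivAt_sqrt_one_add_sq (u : ℝ) :
    HasDerivAt (fun u : ℝ => √(1 + u ^ 2)) (u / √(1 + u ^ 2)) u := by
  have h0 : (1 + u ^ 2) ≠ 0 := by positivity
  have h := ((hasDerivAt_pow 2 u).const_add 1).sqrt h0
  convert! h using 1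
  have : √(1 + u ^ 2) ≠ 0 := by positivity
  field_simp
  simp [mul_comm]

theorem hasDerivAt_cdfShift (x u : ℝ) :
    HasDerivAt (cdfShift x)
      (normalPDF (x * √(1 + u ^ 2) - u) * (x * u / √(1 + u ^ 2) - 1)) u := by
  have h1 : HasDerivAt (fun u => x * √(1 + u ^ 2) - u) (x * (u / √(1 + u ^ 2)) - 1) u :=
    ((hasDerivAt_sqrt_one_add_sq u).const_mul x).sub (hasDerivAt_id u)
  have h2 := (HasDerivAt.comp (h := fun u => x * √(1 + u ^ 2) - u) u
    (hasDerivAt_normalCDF (x * √(1 + u ^ 2) - u)) h1).sub_const (normalCDF x)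
  convert! h2 using 1
  ring

theorem normalPDF_shift (x u : ℝ) :
    normalPDF (x * √(1 + u ^ 2) - u)
      = normalPDF x * Real.exp (x * u * √(1 + u ^ 2) - (x ^ 2 + 1) * u ^ 2 / 2) := by
  rw [normalPDF_eq, normalPDF_eq, mul_assoc, ← Real.exp_add]
  have hs : √(1 + u ^ 2) ^ 2 = 1 + u ^ 2 := Real.sq_sqrt (by positivity)
  congr 2
  linear_combination (-x ^ 2 / 2) * hs

/-- Second-order Taylor bound for `exp` that does not blow up at `-∞`. -/
theorem abs_exp_sub_taylor_two_le (E : ℝ) :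
    |Real.exp E - 1 - E - E ^ 2 / 2| ≤ 3 * |E| ^ 3 * max 1 (Real.exp E) := by
  have hC := Complex.norm_exp_sub_sum_le_norm_mul_exp (E : ℂ) 3
  have hR : |Real.exp E - 1 - E - E ^ 2 / 2| ≤ |E| ^ 3 * Real.exp |E| := by
    have : (Complex.exp E - ∑ m ∈ Finset.range 3, (E : ℂ) ^ m / (m.factorial : ℂ))
        = ((Real.exp E - 1 - E - E ^ 2 / 2 : ℝ) : ℂ) := by
      simp [Finset.sum_range_succ, Nat.factorial]; ring
    rw [this, Complex.norm_real, Complex.norm_real] at hC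
    simpa using hC
  have h3 : 0 ≤ |E| ^ 3 := by positivity
  rcases le_total 0 E with h | h
  · rw [abs_of_nonneg h] at hR h3 ⊢
    calc _ ≤ E ^ 3 * Real.exp E := hR
      _ ≤ E ^ 3 * max 1 (Real.exp E) := by gcongr; exact le_max_right _ _
      _ ≤ 3 * E ^ 3 * max 1 (Real.exp E) := by
        have : 0 ≤ E ^ 3 * max 1 (Real.exp E) := by positivity
        linarith
  · have hm : 3 * |E| ^ 3 * 1 ≤ 3 * |E| ^ 3 * max 1 (Real.exp E) := by
      gcongr; exact le_max_left _ _
    refine le_trans ?_ hm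
    rcases le_total (-1) E with h1 | h1
    · have : Real.exp |E| ≤ 3 := by
        refine (Real.exp_le_exp.2 (abs_le.2 ⟨h1, by linarith⟩)).trans ?_
        linarith [Real.exp_one_lt_d9]
      nlinarith
    · have he : Real.exp E ≤ 1 := Real.exp_le_one_iff.2 h
      have he0 := Real.exp_pos E
      rw [abs_of_nonpos h, abs_le]
      constructor <;>
        nlinarith [sq_nonneg E, sq_nonneg (E + 1),
          mul_nonneg (sq_nonneg E) (by linarith : 0 ≤ -1 - E)]

/-- The algebraic part of the second-order expansion of `∂ᵤ cdfShift x u`. Here `E` is the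
exponent in `normalPDF_shift` and `w = x u / √(1 + u²)`; both are `x u` to first order, and the
coefficient of `u` in `(1 + E + E² / 2) (w - 1)` vanishes. -/
theorem abs_quadratic_part_le {x u s : ℝ} (hu : |u| ≤ 1) (hs1 : 1 ≤ s) (hs : s ^ 2 = 1 + u ^ 2) :
    |(1 + (x * u * s - (x ^ 2 + 1) * u ^ 2 / 2) + (x * u * s - (x ^ 2 + 1) * u ^ 2 / 2) ^ 2 / 2)
        * (x * u / s - 1) + 1 - (x ^ 2 + 1 / 2) * u ^ 2| ≤ 20 * (1 + |x|) ^ 6 * |u| ^ 3 ∧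
      |x * u * s - (x ^ 2 + 1) * u ^ 2 / 2| ≤ 3 * (1 + |x|) ^ 2 * |u| ∧
      |x * u / s - 1| ≤ 1 + |x| := by
  have hs0 : 0 < s := by linarith
  set a := |x| with ha
  set v := |u| with hv
  have ha0 : 0 ≤ a := abs_nonneg x
  have hv0 : 0 ≤ v := abs_nonneg u
  have hx2 : x ^ 2 = a ^ 2 := (sq_abs x).symm
  have hu2 : u ^ 2 = v ^ 2 := (sq_abs u).symm
  have hxu : |x * u| = a * v := abs_mul x u
  set M := 1 + a with hM
  have hM1 : 1 ≤ M := by linarith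
  have hsle : s - 1 ≤ v ^ 2 / 2 := by rw [← hu2]; nlinarith
  -- the deviations of `w` and of `E` from `x u`
  obtain ⟨σ, hσ⟩ : ∃ σ, σ = x * u / s - x * u := ⟨_, rfl⟩
  obtain ⟨ρ, hρ⟩ : ∃ ρ, ρ = x * u * (s - 1) := ⟨_, rfl⟩
  obtain ⟨e, he⟩ : ∃ e, e = ρ - (x ^ 2 + 1) * u ^ 2 / 2 := ⟨_, rfl⟩
  have hv3 : v ^ 3 ≤ v ^ 2 := by nlinarith [sq_nonneg v]
  have hv2 : v ^ 2 ≤ v := by nlinarith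
  have hρb : |ρ| ≤ a * v ^ 3 := by
    rw [hρ, abs_mul, hxu, abs_of_nonneg (by linarith : 0 ≤ s - 1)]
    have := mul_le_mul_of_nonneg_left hsle (mul_nonneg ha0 hv0)
    nlinarith [mul_nonneg ha0 (pow_nonneg hv0 3)]
  have hσb : |σ| ≤ a * v ^ 3 := by
    have : σ = -(x * u) * ((s - 1) / s) := by rw [hσ]; field_simp; ring
    rw [this, abs_mul, abs_neg, hxu, abs_of_nonneg (div_nonneg (by linarith) hs0.le)]
    have h1 : (s - 1) / s ≤ v ^ 2 / 2 := (div_le_self (by linarith) hs1).trans hsle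
    have := mul_le_mul_of_nonneg_left h1 (mul_nonneg ha0 hv0)
    nlinarith [mul_nonneg ha0 (pow_nonneg hv0 3)]
  have heb : |e| ≤ 2 * M ^ 2 * v ^ 2 := by
    rw [he]
    refine (abs_sub _ _).trans ?_
    rw [abs_of_nonneg (by positivity : 0 ≤ (x ^ 2 + 1) * u ^ 2 / 2), hx2, hu2]
    have : a * v ^ 3 ≤ a * v ^ 2 := by gcongr
    nlinarith [sq_nonneg v, mul_nonneg ha0 (sq_nonneg v)]
  have hw : x * u / s = x * u + σ := by rw [hσ]; ring
  have hE : x * u * s - (x ^ 2 + 1) * u ^ 2 / 2 = x * u + e := by rw [he, hρ]; ring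
  have haM : a ≤ M := by linarith
  have hEb : |x * u + e| ≤ 3 * M ^ 2 * v := by
    refine (abs_add_le _ _).trans ?_
    rw [hxu]
    have h1 : a * v ≤ M ^ 2 * v := by gcongr; nlinarith
    have h2 : 2 * M ^ 2 * v ^ 2 ≤ 2 * M ^ 2 * v := by gcongr
    linarith
  have hwb : |x * u + σ| ≤ a * v := by
    rw [← hw, abs_div, hxu, abs_of_pos hs0]
    exact div_le_self (mul_nonneg ha0 hv0) hs1
  refine ⟨?_, by rw [hE]; exact hEb, ?_⟩
  · have key : (1 + (x * u + e) + (x * u + e) ^ 2 / 2) * (x * u + σ - 1) + 1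
        - (x ^ 2 + 1 / 2) * u ^ 2
        = (σ - ρ) + σ * (x * u + e) - e ^ 2 / 2 + (x * u + σ) * (x * u + e) ^ 2 / 2 := by
      have : ρ = e + (x ^ 2 + 1) * u ^ 2 / 2 := by rw [he]; ring
      rw [this]; ring
    rw [hE, hw, key]
    have hP : 0 ≤ M ^ 6 * v ^ 3 := by positivity
    have t1 : |σ - ρ| ≤ 2 * (M ^ 6 * v ^ 3) := by
      refine (abs_sub _ _).trans ?_
      have : a * v ^ 3 ≤ M ^ 6 * v ^ 3 := by
        gcongr; exact haM.trans (le_self_pow₀ hM1 (by norm_num))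
      linarith
    have t2 : |σ * (x * u + e)| ≤ 3 * (M ^ 6 * v ^ 3) := by
      rw [abs_mul]
      calc |σ| * |x * u + e| ≤ (a * v ^ 3) * (3 * M ^ 2 * v) := by gcongr
        _ ≤ (M ^ 4 * v ^ 3) * (3 * M ^ 2 * 1) := by
          gcongr; exact haM.trans (le_self_pow₀ hM1 (by norm_num))
        _ = _ := by ring
    have t3 : |e ^ 2 / 2| ≤ 2 * (M ^ 6 * v ^ 3) := by
      rw [abs_div, abs_pow, abs_two]
      calc |e| ^ 2 / 2 ≤ (2 * M ^ 2 * v ^ 2) ^ 2 / 2 := by gcongr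
        _ = 2 * (M ^ 4 * (v ^ 3 * v)) := by ring
        _ ≤ 2 * (M ^ 6 * (v ^ 3 * 1)) := by
          gcongr
          · norm_num
        _ = _ := by ring
    have t4 : |(x * u + σ) * (x * u + e) ^ 2 / 2| ≤ 5 * (M ^ 6 * v ^ 3) := by
      rw [abs_div, abs_mul, abs_pow, abs_two]
      calc |x * u + σ| * |x * u + e| ^ 2 / 2 ≤ (a * v) * (3 * M ^ 2 * v) ^ 2 / 2 := by gcongr
        _ ≤ (M ^ 2 * v) * (3 * M ^ 2 * v) ^ 2 / 2 := by
          gcongr; exact haM.trans (le_self_pow₀ hM1 (by norm_num))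
        _ ≤ _ := by linarith
    rw [abs_le] at t1 t2 t3 t4 ⊢
    constructor <;> linarith
  · rw [hw]
    refine (abs_sub _ _).trans ?_
    rw [abs_one]
    have : a * v ≤ a * 1 := by gcongr
    linarith

/-- Polynomial growth in `x` is absorbed by the Gaussian factor. -/
theorem pow_mul_exp_neg_sq_le (x : ℝ) : (1 + |x|) ^ 7 * Real.exp (-x ^ 2 / 4) ≤ Real.exp 49 := by
  have h1 : 1 + |x| ≤ Real.exp |x| := by linarith [Real.add_one_le_exp |x|]
  calc (1 + |x|) ^ 7 * Real.exp (-x ^ 2 / 4)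
      ≤ Real.exp |x| ^ 7 * Real.exp (-x ^ 2 / 4) := by gcongr
    _ = Real.exp (7 * |x| + -x ^ 2 / 4) := by
      rw [Real.exp_add, ← Real.exp_nat_mul]; norm_num
    _ ≤ Real.exp 49 := by
      apply Real.exp_le_exp.2
      rw [← sq_abs x]; nlinarith [sq_nonneg (|x| / 2 - 7)]

theorem abs_deriv_cdfShift_sub_le :
    ∃ C : ℝ, 0 < C ∧ ∀ x u : ℝ, |u| ≤ 1 →
      |normalPDF (x * √(1 + u ^ 2) - u) * (x * u / √(1 + u ^ 2) - 1)
        + normalPDF x - normalPDF x * (x ^ 2 + 1 / 2) * u ^ 2| ≤ C * |u| ^ 3 := by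
  refine ⟨200 * Real.exp (1 / 2) * Real.exp 49, by positivity, fun x u hu => ?_⟩
  have hs : √(1 + u ^ 2) ^ 2 = 1 + u ^ 2 := Real.sq_sqrt (by positivity)
  obtain ⟨hq, hE, hw⟩ := abs_quadratic_part_le (x := x) hu (one_le_sqrt_one_add_sq u) hs
  have hshift := normalPDF_shift x u
  have hp := normalPDF_le (x * √(1 + u ^ 2) - u)
  have hp' := normalPDF_le x
  have hφ := normalPDF_pos x
  set s := √(1 + u ^ 2)
  set E := x * u * s - (x ^ 2 + 1) * u ^ 2 / 2
  set w := x * u / s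
  set M := 1 + |x|
  have hM1 : 1 ≤ M := by simp [M]
  have hR := abs_exp_sub_taylor_two_le E
  set R := Real.exp E - 1 - E - E ^ 2 / 2
  have hu2 : u ^ 2 ≤ 1 := by rw [← sq_abs]; exact pow_le_one₀ (abs_nonneg u) hu
  -- the Gaussian factor survives at the shifted point because `(x s - u)² ≥ x² / 2 - u²`
  have hmax : normalPDF x * max 1 (Real.exp E) ≤ Real.exp (1 / 2) * Real.exp (-x ^ 2 / 4) := by
    rw [mul_max_of_nonneg _ _ hφ.le, mul_one, ← hshift, ← Real.exp_add]
    refine max_le (hp'.trans (Real.exp_le_exp.2 ?_)) (hp.trans (Real.exp_le_exp.2 ?_))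
    · nlinarith [sq_nonneg x]
    · nlinarith [sq_nonneg (x * s / 2 - u), sq_nonneg (x * u), sq_nonneg (x * s - 2 * u)]
  have hid : normalPDF (x * s - u) * (w - 1) + normalPDF x - normalPDF x * (x ^ 2 + 1 / 2) * u ^ 2
      = normalPDF x * (((1 + E + E ^ 2 / 2) * (w - 1) + 1 - (x ^ 2 + 1 / 2) * u ^ 2)
        + R * (w - 1)) := by
    rw [hshift]; simp only [R]; ring
  rw [hid, abs_mul, abs_of_pos hφ]
  have hm1 : 1 ≤ max 1 (Real.exp E) := le_max_left _ _
  have hin : |((1 + E + E ^ 2 / 2) * (w - 1) + 1 - (x ^ 2 + 1 / 2) * u ^ 2) + R * (w - 1)|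
      ≤ 200 * M ^ 7 * |u| ^ 3 * max 1 (Real.exp E) := by
    refine (abs_add_le _ _).trans ?_
    have h1 : |R * (w - 1)| ≤ 81 * M ^ 7 * |u| ^ 3 * max 1 (Real.exp E) := by
      rw [abs_mul]
      calc |R| * |w - 1| ≤ (3 * (3 * M ^ 2 * |u|) ^ 3 * max 1 (Real.exp E)) * M := by
            gcongr; exact hR.trans (by gcongr)
        _ = _ := by ring
    have h2 : 20 * M ^ 6 * |u| ^ 3 ≤ 20 * M ^ 7 * |u| ^ 3 * max 1 (Real.exp E) := by
      calc 20 * M ^ 6 * |u| ^ 3 ≤ 20 * M ^ 7 * |u| ^ 3 := by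
            gcongr
            · norm_num
        _ ≤ _ := le_mul_of_one_le_right (by positivity) hm1
    have h3 : 0 ≤ M ^ 7 * |u| ^ 3 * max 1 (Real.exp E) := by positivity
    linarith
  calc normalPDF x * _ ≤ normalPDF x * (200 * M ^ 7 * |u| ^ 3 * max 1 (Real.exp E)) := by gcongr
    _ = 200 * M ^ 7 * |u| ^ 3 * (normalPDF x * max 1 (Real.exp E)) := by ring
    _ ≤ 200 * M ^ 7 * |u| ^ 3 * (Real.exp (1 / 2) * Real.exp (-x ^ 2 / 4)) := by gcongr
    _ = 200 * Real.exp (1 / 2) * (M ^ 7 * Real.exp (-x ^ 2 / 4)) * |u| ^ 3 := by ring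
    _ ≤ 200 * Real.exp (1 / 2) * Real.exp 49 * |u| ^ 3 := by
      gcongr; exact pow_mul_exp_neg_sq_le x

/-- The expansion of `cdfShift x u` at `u = 0`, uniformly in `x`: the quadratic term is absent. -/
theorem abs_cdfShift_sub_cubic_le :
    ∃ C : ℝ, 0 < C ∧ ∀ x u : ℝ, |u| ≤ 1 →
      |cdfShift x u + normalPDF x * u - normalPDF x * (2 * x ^ 2 + 1) / 6 * u ^ 3|
        ≤ C * u ^ 4 := by
  obtain ⟨C, hC, h⟩ := abs_deriv_cdfShift_sub_le
  refine ⟨C, hC, fun x u hu => ?_⟩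
  set G : ℝ → ℝ := fun u => cdfShift x u + normalPDF x * u
    - normalPDF x * (2 * x ^ 2 + 1) / 6 * u ^ 3 with hG
  have hd : ∀ y, HasDerivAt G (normalPDF (x * √(1 + y ^ 2) - y) * (x * y / √(1 + y ^ 2) - 1)
        + normalPDF x - normalPDF x * (x ^ 2 + 1 / 2) * y ^ 2) y := by
    intro y
    have h1 := ((hasDerivAt_cdfShift x y).add ((hasDerivAt_id y).const_mul (normalPDF x))).sub
      ((hasDerivAt_pow 3 y).const_mul (normalPDF x * (2 * x ^ 2 + 1) / 6))
    convert! h1 using 1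
    push_cast; ring
  have hb : ∀ y ∈ Set.uIcc 0 u, ‖normalPDF (x * √(1 + y ^ 2) - y) * (x * y / √(1 + y ^ 2) - 1)
        + normalPDF x - normalPDF x * (x ^ 2 + 1 / 2) * y ^ 2‖ ≤ C * |u| ^ 3 := by
    intro y hy
    have hyu : |y| ≤ |u| := by
      have := Set.abs_sub_left_of_mem_uIcc hy
      simpa using this
    exact (h x y (hyu.trans hu)).trans (by gcongr)
  have := (convex_uIcc 0 u).norm_image_sub_le_of_norm_hasDerivWithin_le
    (fun y _ => (hd y).hasDerivWithinAt) hb Set.left_mem_uIcc Set.right_mem_uIcc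
  have h0 : G 0 = 0 := by simp [hG, cdfShift_zero]
  rw [h0, sub_zero, sub_zero, Real.norm_eq_abs, Real.norm_eq_abs] at this
  calc _ ≤ C * |u| ^ 3 * |u| := this
    _ = C * |u| ^ 4 := by ring
    _ = C * u ^ 4 := by rw [Even.pow_abs (by decide)]

theorem nonneg_of_hasDerivAt_nonneg {f f' : ℝ → ℝ} (hf : ∀ t, HasDerivAt f (f' t) t) (h0 : f 0 = 0)
    (hf' : ∀ t, 0 ≤ t → 0 ≤ f' t) {t : ℝ} (ht : 0 ≤ t) : 0 ≤ f t := by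
  have hm : MonotoneOn f (Set.Ici 0) := monotoneOn_of_deriv_nonneg (convex_Ici 0)
    (fun t _ => (hf t).continuousAt.continuousWithinAt)
    (fun t _ => (hf t).differentiableAt.differentiableWithinAt)
    (fun t h => by rw [(hf t).deriv]; exact hf' t (by simpa using (interior_subset h)))
  simpa [h0] using hm (Set.mem_Ici.2 le_rfl) (Set.mem_Ici.2 ht) ht

/-- A convergent of the continued fraction `t coth t = 1 + t² / (3 + t² / (5 + ⋯))`, cleared of
denominators. -/
theorem sq_mul_sinh_le {t : ℝ} (ht : 0 ≤ t) :
    5 * t ^ 2 * Real.sinh t ≤ (15 + t ^ 2) * (t * Real.cosh t - Real.sinh t) := by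
  have hs := Real.hasDerivAt_sinh
  have hc := Real.hasDerivAt_cosh
  have hi := fun t : ℝ => hasDerivAt_id t
  have hsq := fun t : ℝ => hasDerivAt_pow 2 t
  have h1 : ∀ t : ℝ, 0 ≤ t → 0 ≤ t * Real.cosh t - Real.sinh t := fun t ht =>
    nonneg_of_hasDerivAt_nonneg (f := fun t => t * Real.cosh t - Real.sinh t)
      (f' := fun t => t * Real.sinh t)
      (fun t => by convert! ((hi t).mul (hc t)).sub (hs t) using 1; simp) (by simp)
      (fun t ht => mul_nonneg ht (Real.sinh_nonneg_iff.2 ht)) ht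
  have h2 : ∀ t : ℝ, 0 ≤ t → 0 ≤ (3 + t ^ 2) * Real.sinh t - 3 * t * Real.cosh t := fun t ht =>
    nonneg_of_hasDerivAt_nonneg (f := fun t => (3 + t ^ 2) * Real.sinh t - 3 * t * Real.cosh t)
      (f' := fun t => t * (t * Real.cosh t - Real.sinh t))
      (fun t => by
        convert! (((hsq t).const_add 3).mul (hs t)).sub (((hi t).const_mul 3).mul (hc t)) using 1
        simp; ring) (by simp)
      (fun t ht => mul_nonneg ht (h1 t ht)) ht
  have h3 := nonneg_of_hasDerivAt_nonneg
      (f := fun t => (15 * t + t ^ 3) * Real.cosh t - (15 + 6 * t ^ 2) * Real.sinh t)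
      (f' := fun t => t * ((3 + t ^ 2) * Real.sinh t - 3 * t * Real.cosh t))
      (fun t => by
        convert! ((((hi t).const_mul 15).add (hasDerivAt_pow 3 t)).mul (hc t)).sub
          ((((hsq t).const_mul 6).const_add 15).mul (hs t)) using 1
        simp; ring) (by simp)
      (fun t ht => mul_nonneg ht (h2 t ht)) ht
  linarith

/-- The antisymmetrisation of `cdfShift` in its first variable. -/
theorem cdfShift_sub_cdfShift_neg (x u : ℝ) :
    cdfShift x u - cdfShift (-x) u
      = normalCDF (x * √(1 + u ^ 2) - u) + normalCDF (x * √(1 + u ^ 2) + u) - 2 * normalCDF x := by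
  have h1 := normalCDF_neg (x * √(1 + u ^ 2) + u)
  have h2 := normalCDF_neg x
  have h3 : -x * √(1 + u ^ 2) - u = -(x * √(1 + u ^ 2) + u) := by ring
  rw [cdfShift, cdfShift, h3, h1, h2]; ring

theorem hasDerivAt_cdfShift_sub_neg (x u : ℝ) :
    HasDerivAt (fun u => cdfShift x u - cdfShift (-x) u)
      (2 * (normalPDF x * Real.exp (-(x ^ 2 + 1) * u ^ 2 / 2))
        * (x * u / √(1 + u ^ 2) * Real.cosh (x * u * √(1 + u ^ 2))
          - Real.sinh (x * u * √(1 + u ^ 2)))) u := by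
  convert! (hasDerivAt_cdfShift x u).sub (hasDerivAt_cdfShift (-x) u) using 1
  rw [normalPDF_shift, normalPDF_shift, normalPDF_neg, Real.cosh_eq, Real.sinh_eq,
    show x * u * √(1 + u ^ 2) - (x ^ 2 + 1) * u ^ 2 / 2
      = -(x ^ 2 + 1) * u ^ 2 / 2 + x * u * √(1 + u ^ 2) by ring,
    show -x * u * √(1 + u ^ 2) - ((-x) ^ 2 + 1) * u ^ 2 / 2
      = -(x ^ 2 + 1) * u ^ 2 / 2 + -(x * u * √(1 + u ^ 2)) by ring, Real.exp_add, Real.exp_add]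
  ring

/-- The threshold `√3`: for `x > √3` the odd part in `x` of `cdfShift x u` is increasing in
`u > 0`, and bounded below by a multiple of `min 1 (u⁴)`. -/
theorem exists_le_cdfShift_sub_neg {x : ℝ} (hx : √3 < x) :
    ∃ c : ℝ, 0 < c ∧ ∀ u : ℝ, c * min 1 (u ^ 4) ≤ cdfShift x u - cdfShift (-x) u := by
  have hx1 : 1 < x := lt_trans (by rw [Real.lt_sqrt] <;> norm_num) hx
  have hx3 : 3 < x ^ 2 := (Real.sqrt_lt' (by linarith)).1 hx
  set k : ℝ → ℝ := fun u => cdfShift x u - cdfShift (-x) u with hk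
  set q : ℝ := 5 * (x ^ 2 - 3) / (15 + 2 * x ^ 2) with hq
  -- the derivative is positive, with the cubic lower bound on `[0, 1]`
  have hker : ∀ u : ℝ, 0 ≤ u → u ≤ 1 → q / 2 * u ^ 3 ≤
      x * u / √(1 + u ^ 2) * Real.cosh (x * u * √(1 + u ^ 2)) - Real.sinh (x * u * √(1 + u ^ 2)) := by
    intro u hu0 hu1
    have hs1 := one_le_sqrt_one_add_sq u
    have hs : √(1 + u ^ 2) ^ 2 = 1 + u ^ 2 := Real.sq_sqrt (by positivity)
    set s := √(1 + u ^ 2)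
    set t := x * u * s with ht
    have ht2 : t ^ 2 = x ^ 2 * u ^ 2 * (1 + u ^ 2) := by rw [ht, mul_pow, mul_pow, hs]
    have hut : u ≤ t := by
      calc u = 1 * u * 1 := by ring
        _ ≤ t := by rw [ht]; gcongr
    have ht0 : 0 ≤ t := hu0.trans hut
    have hsh : u ≤ Real.sinh t := hut.trans (Real.self_le_sinh_iff.2 ht0)
    have hw : x * u / s = t / (1 + u ^ 2) := by rw [ht, ← hs]; field_simp
    have hu2 : u ^ 2 ≤ 1 := pow_le_one₀ hu0 hu1
    have hlow : (q * u ^ 2) * (15 + t ^ 2) ≤ 5 * t ^ 2 - u ^ 2 * (15 + t ^ 2) := by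
      have h1 : t ^ 2 ≤ 2 * x ^ 2 := by
        rw [ht2]; nlinarith [mul_nonneg (sq_nonneg x) (by nlinarith : 0 ≤ 2 - u ^ 2 * (1 + u ^ 2))]
      have h2 : q * (15 + t ^ 2) ≤ 5 * (x ^ 2 - 3) := by
        calc q * (15 + t ^ 2) ≤ q * (15 + 2 * x ^ 2) := by gcongr
          _ = _ := by rw [hq]; field_simp
      have h3 : 5 * (x ^ 2 - 3) ≤ x ^ 2 * (1 + u ^ 2) * (5 - u ^ 2) - 15 := by
        nlinarith [mul_nonneg (mul_nonneg (sq_nonneg x) (sq_nonneg u)) (by linarith : 0 ≤ 4 - u ^ 2)]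
      have h4 := mul_le_mul_of_nonneg_left (h2.trans h3) (sq_nonneg u)
      rw [ht2] at h4 ⊢
      linarith
    have hmain : q * u ^ 2 * Real.sinh t ≤ t * Real.cosh t - (1 + u ^ 2) * Real.sinh t := by
      have h5 := sq_mul_sinh_le ht0
      have h6 := mul_le_mul_of_nonneg_right hlow (hu0.trans hsh)
      have h7 : 0 < 15 + t ^ 2 := by positivity
      refine le_of_mul_le_mul_left ?_ h7
      linarith
    have h8 : q * u ^ 3 ≤ t * Real.cosh t - (1 + u ^ 2) * Real.sinh t := by
      refine le_trans ?_ hmain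
      calc q * u ^ 3 = q * u ^ 2 * u := by ring
        _ ≤ _ := by gcongr
    have h9 : x * u / s * Real.cosh t - Real.sinh t
        = (t * Real.cosh t - (1 + u ^ 2) * Real.sinh t) / (1 + u ^ 2) := by
      rw [hw]; field_simp
    rw [h9, le_div_iff₀ (by positivity)]
    have : 0 ≤ q * u ^ 3 := by positivity
    nlinarith
  have hker' : ∀ u : ℝ, 0 ≤ u → 0 ≤
      x * u / √(1 + u ^ 2) * Real.cosh (x * u * √(1 + u ^ 2)) - Real.sinh (x * u * √(1 + u ^ 2)) := by
    intro u hu0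
    rcases le_total u 1 with h | h
    · exact le_trans (by positivity) (hker u hu0 h)
    · have hs1 := one_le_sqrt_one_add_sq u
      have : 1 ≤ x * u / √(1 + u ^ 2) := by
        rw [one_le_div (by linarith)]
        apply Real.sqrt_le_iff.2 ⟨by positivity, ?_⟩
        nlinarith [mul_nonneg (by linarith : 0 ≤ x ^ 2 - 3) (sq_nonneg u)]
      have h2 := Real.sinh_lt_cosh (x * u * √(1 + u ^ 2))
      have h3 := Real.cosh_pos (x * u * √(1 + u ^ 2))
      nlinarith
  set N : ℝ := normalPDF x * Real.exp (-(x ^ 2 + 1) / 2) with hN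
  have hN0 : 0 < N := mul_pos (normalPDF_pos x) (Real.exp_pos _)
  have hk0 : k 0 = 0 := by simp [hk, cdfShift_zero]
  have hd := hasDerivAt_cdfShift_sub_neg x
  have hφ := (normalPDF_pos x).le
  have hmono : MonotoneOn k (Set.Ici 0) := monotoneOn_of_deriv_nonneg (convex_Ici 0)
    (fun t _ => (hd t).continuousAt.continuousWithinAt)
    (fun t _ => (hd t).differentiableAt.differentiableWithinAt)
    (fun t h => by
      rw [(hd t).deriv]
      have := hker' t (by simpa using (interior_subset h))
      positivity)
  have hlow : ∀ u : ℝ, 0 ≤ u → u ≤ 1 → N * q / 4 * u ^ 4 ≤ k u := by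
    have hm : MonotoneOn (fun u => k u - N * q / 4 * u ^ 4) (Set.Icc 0 1) := by
      have hd' := fun u => (hd u).sub ((hasDerivAt_pow 4 u).const_mul (N * q / 4))
      refine monotoneOn_of_deriv_nonneg (convex_Icc 0 1)
        (fun t _ => (hd' t).continuousAt.continuousWithinAt)
        (fun t _ => (hd' t).differentiableAt.differentiableWithinAt) (fun t h => ?_)
      have ht : t ∈ Set.Icc (0 : ℝ) 1 := interior_subset h
      erw [(hd' t).deriv]
      have h1 := hker t ht.1 ht.2
      have h2 : N ≤ normalPDF x * Real.exp (-(x ^ 2 + 1) * t ^ 2 / 2) := by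
        rw [hN]; gcongr
        have : t ^ 2 ≤ 1 := pow_le_one₀ ht.1 ht.2
        nlinarith [sq_nonneg x]
      have h3 := mul_le_mul h2 h1 (by have := ht.1; positivity) (by positivity)
      push_cast
      linarith
    intro u h0 h1
    have := hm (Set.left_mem_Icc.2 zero_le_one) ⟨h0, h1⟩ h0
    have h : k 0 - N * q / 4 * 0 ^ 4 ≤ k u - N * q / 4 * u ^ 4 := this
    rw [hk0] at h
    linarith
  have hnn : ∀ u : ℝ, 0 ≤ u → N * q / 4 * min 1 (u ^ 4) ≤ k u := by
    intro u hu
    rcases le_total u 1 with h | h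
    · rw [min_eq_right (pow_le_one₀ hu h)]; exact hlow u hu h
    · rw [min_eq_left (one_le_pow₀ h)]
      have h1 := hlow 1 zero_le_one le_rfl
      have h2 := hmono (Set.mem_Ici.2 zero_le_one) (Set.mem_Ici.2 hu) h
      linarith
  refine ⟨N * q / 4, by positivity, fun u => ?_⟩
  rcases le_total 0 u with h | h
  · exact hnn u h
  · -- the odd part in `x` is even in `u`
    have h1 := hnn (-u) (by linarith)
    have h2 : k (-u) = k u := by
      simp only [hk, cdfShift_sub_cdfShift_neg, neg_sq]; ring_nf
    rw [h2, Even.neg_pow (by decide)] at h1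
    exact h1

/-- `(2 x² + 1) φ(x)` is bounded. -/
theorem exists_normalPDF_mul_sq_le :
    ∃ C : ℝ, 0 < C ∧ ∀ x : ℝ, normalPDF x ≤ C ∧ normalPDF x * (2 * x ^ 2 + 1) / 6 ≤ C := by
  refine ⟨Real.exp 49, Real.exp_pos _, fun x => ?_⟩
  have h1 : normalPDF x ≤ Real.exp (-x ^ 2 / 4) :=
    (normalPDF_le x).trans (Real.exp_le_exp.2 (by nlinarith [sq_nonneg x]))
  have hM : 1 ≤ 1 + |x| := by linarith [abs_nonneg x]
  have h2 := pow_mul_exp_neg_sq_le x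
  have h3 := (normalPDF_pos x).le
  have h4 : (2 * x ^ 2 + 1) / 6 ≤ (1 + |x|) ^ 7 := by
    have : (1 + |x|) ^ 2 ≤ (1 + |x|) ^ 7 := pow_le_pow_right₀ hM (by norm_num)
    nlinarith [abs_nonneg x, sq_abs x]
  constructor
  · calc normalPDF x ≤ 1 * Real.exp (-x ^ 2 / 4) := by linarith
      _ ≤ (1 + |x|) ^ 7 * Real.exp (-x ^ 2 / 4) := by gcongr; exact one_le_pow₀ hM
      _ ≤ _ := h2
  · calc normalPDF x * (2 * x ^ 2 + 1) / 6 = (2 * x ^ 2 + 1) / 6 * normalPDF x := by ring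
      _ ≤ (1 + |x|) ^ 7 * Real.exp (-x ^ 2 / 4) := by gcongr
      _ ≤ _ := h2

/-! ### Truncated moments and tails of a law on the line -/

/-- The two-sided tail `μ {y | x < |y|}`. -/
def tailProb (μ : Measure ℝ) (x : ℝ) : ℝ := μ.real {y | x < |y|}

section Truncation

theorem measurableSet_abs_le (x : ℝ) : MeasurableSet {y : ℝ | |y| ≤ x} :=
  measurableSet_le measurable_id.abs measurable_const

theorem measurableSet_lt_abs (x : ℝ) : MeasurableSet {y : ℝ | x < |y|} :=
  measurableSet_lt measurable_const measurable_id.abs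

variable {μ : Measure ℝ}

theorem tailProb_eq_integral (x : ℝ) :
    tailProb μ x = ∫ y, {y : ℝ | x < |y|}.indicator (fun _ => (1 : ℝ)) y ∂μ := by
  rw [integral_indicator_const _ (measurableSet_lt_abs x)]; simp [tailProb]

theorem truncMoment_id (k : ℕ) (x : ℝ) :
    truncMoment μ id k x = ∫ y, {y : ℝ | |y| ≤ x}.indicator (fun y => y ^ k) y ∂μ := rfl

theorem tailProb_nonneg (x : ℝ) : 0 ≤ tailProb μ x := measureReal_nonneg

theorem truncMoment_nonneg {k : ℕ} (hk : Even k) (x : ℝ) : 0 ≤ truncMoment μ id k x :=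
  integral_nonneg fun _ => Set.indicator_nonneg (fun _ _ => hk.pow_nonneg _) _

variable [IsProbabilityMeasure μ]

theorem integrable_truncated (k : ℕ) (x : ℝ) :
    Integrable ({y : ℝ | |y| ≤ x}.indicator (fun y => y ^ k)) μ := by
  refine Integrable.of_bound
    ((measurable_id.pow_const k).indicator (measurableSet_abs_le x)).aestronglyMeasurable (|x| ^ k)
    (Eventually.of_forall fun y => ?_)
  rw [Set.indicator_apply]
  split_ifs with h
  · rw [norm_pow, Real.norm_eq_abs]
    exact pow_le_pow_left₀ (abs_nonneg y) (le_trans h (le_abs_self x)) k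
  · simp

theorem integrable_tailIndicator (x : ℝ) :
    Integrable ({y : ℝ | x < |y|}.indicator (fun _ => (1 : ℝ))) μ :=
  (integrable_const 1).indicator (measurableSet_lt_abs x)

theorem tailProb_anti {x y : ℝ} (h : x ≤ y) : tailProb μ y ≤ tailProb μ x :=
  measureReal_mono fun _ hz => lt_of_le_of_lt h hz

theorem truncMoment_mono {k : ℕ} (hk : Even k) {x y : ℝ} (h : x ≤ y) :
    truncMoment μ id k x ≤ truncMoment μ id k y := by
  refine integral_mono (integrable_truncated k x) (integrable_truncated k y) fun z => ?_
  exact Set.indicator_le_indicator_of_subset (fun w hw => le_trans hw h)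
    (fun w => hk.pow_nonneg w) z

theorem mul_tailProb_le (hint : Integrable id μ) (x : ℝ) : x * tailProb μ x ≤ ∫ y, |y| ∂μ := by
  rw [tailProb_eq_integral, ← integral_const_mul]
  refine integral_mono ((integrable_tailIndicator x).const_mul x) hint.abs fun y => ?_
  simp only [Set.indicator_apply, Set.mem_ofPred_eq]
  split_ifs with h
  · linarith
  · simp

theorem tendsto_tailProb (hint : Integrable id μ) : Tendsto (tailProb μ) atTop (𝓝 0) := by
  have h : Tendsto (fun x : ℝ => (∫ y, |y| ∂μ) / x) atTop (𝓝 0) :=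
    tendsto_const_nhds.div_atTop tendsto_id
  refine tendsto_of_tendsto_of_tendsto_of_le_of_le' tendsto_const_nhds h
    (Eventually.of_forall tailProb_nonneg) ?_
  filter_upwards [eventually_gt_atTop 0] with x hx
  rw [le_div_iff₀ hx, mul_comm]
  exact mul_tailProb_le hint x

/-- `U(x) = E[X² I(|X| ≤ x)]` grows at most linearly for an integrable variable. -/
theorem truncMoment_two_le (hint : Integrable id μ) {x : ℝ} (hx : 0 ≤ x) :
    truncMoment μ id 2 x ≤ x * ∫ y, |y| ∂μ := by
  rw [truncMoment_id, ← integral_const_mul]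
  refine integral_mono (integrable_truncated 2 x) (hint.abs.const_mul x) fun y => ?_
  simp only [Set.indicator_apply, Set.mem_ofPred_eq]
  split_ifs with h
  · rw [← sq_abs, sq]; exact mul_le_mul_of_nonneg_right h (abs_nonneg y)
  · exact mul_nonneg hx (abs_nonneg y)

/-- Moving the truncation level from `x` to `y ≥ x` adds at most `y^k P(|X| > x)`. -/
theorem truncMoment_le_add {k : ℕ} (hk : Even k) {x y : ℝ} (hxy : x ≤ y) :
    truncMoment μ id k y ≤ truncMoment μ id k x + y ^ k * tailProb μ x := by
  rw [truncMoment_id, truncMoment_id, tailProb_eq_integral, ← integral_const_mul,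
    ← integral_add (integrable_truncated k x) ((integrable_tailIndicator x).const_mul _)]
  refine integral_mono (integrable_truncated k y)
    ((integrable_truncated k x).add ((integrable_tailIndicator x).const_mul _)) fun z => ?_
  simp only [Set.indicator_apply, Set.mem_ofPred_eq]
  have h1 : |z| ≤ y → z ^ k ≤ y ^ k := fun h => by
    rw [← hk.pow_abs z]; exact pow_le_pow_left₀ (abs_nonneg z) h k
  by_cases h : |z| ≤ x
  · simp [h, h.trans hxy, not_lt.2 h]
  · have h' : x < |z| := not_le.1 h
    by_cases h2 : |z| ≤ y
    · simp [h, h', h2, h1 h2]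
    · simp [h, h', h2, hk.pow_nonneg y]

end Truncation

/-! ### The defect `E(1 - cos tX)` -/

/-- `E(1 - cos t X)`, the defect of the real part of the characteristic function. -/
def cosDefect (μ : Measure ℝ) (t : ℝ) : ℝ := ∫ y, (1 - Real.cos (t * y)) ∂μ

/-- `E sin t X`, the imaginary part of the characteristic function. -/
def sinMean (μ : Measure ℝ) (t : ℝ) : ℝ := ∫ y, Real.sin (t * y) ∂μ

section CosDefect

variable {μ : Measure ℝ}

theorem cosDefect_nonneg (t : ℝ) : 0 ≤ cosDefect μ t :=
  integral_nonneg fun _ => sub_nonneg.2 (Real.cos_le_one _)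

/-- `E sin tX = o(t)` for a centred variable. -/
theorem tendsto_sinMean_div (hint : Integrable id μ) (hmean : ∫ y, y ∂μ = 0) :
    Tendsto (fun t => sinMean μ t / t) (𝓝[≠] 0) (𝓝 0) := by
  have h : ∀ t, sinMean μ t / t = ∫ y, Real.sin (t * y) / t ∂μ := fun t => by
    rw [sinMean, integral_div]
  simp_rw [h]
  suffices key : Tendsto (fun t => ∫ y, Real.sin (t * y) / t ∂μ) (𝓝[≠] 0) (𝓝 (∫ y, y ∂μ)) by
    rwa [hmean] at key
  refine tendsto_integral_filter_of_dominated_convergence (fun y => |y|) ?_ ?_ hint.abs ?_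
  · exact Eventually.of_forall fun t => (by fun_prop : Measurable _).aestronglyMeasurable
  · refine eventually_mem_nhdsWithin.mono fun t ht => Eventually.of_forall fun y => ?_
    have h0 : 0 < |t| := abs_pos.2 ht
    rw [Real.norm_eq_abs, abs_div, div_le_iff₀ h0]
    calc |Real.sin (t * y)| ≤ |t * y| := Real.abs_sin_le_abs
      _ = |y| * |t| := by rw [abs_mul, mul_comm]
  · refine Eventually.of_forall fun y => ?_
    have hd : HasDerivAt (fun t => Real.sin (t * y)) y 0 := by
      have := ((hasDerivAt_id (0 : ℝ)).mul_const y).sin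
      simpa using this
    have := hd.tendsto_slope
    refine this.congr fun t => ?_
    simp [slope_def_field]

variable [IsProbabilityMeasure μ]

theorem integrable_cos (t : ℝ) : Integrable (fun y => Real.cos (t * y)) μ :=
  Integrable.of_bound (by fun_prop) 1
    (Eventually.of_forall fun y => by simpa using Real.abs_cos_le_one _)

theorem integrable_sin (t : ℝ) : Integrable (fun y => Real.sin (t * y)) μ :=
  Integrable.of_bound (by fun_prop) 1
    (Eventually.of_forall fun y => by simpa using Real.abs_sin_le_one _)

theorem integrable_one_sub_cos (t : ℝ) : Integrable (fun y => 1 - Real.cos (t * y)) μ :=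
  (integrable_const 1).sub (integrable_cos t)

theorem normSq_charFun (t : ℝ) :
    ‖charFun μ t‖ ^ 2 = (1 - cosDefect μ t) ^ 2 + sinMean μ t ^ 2 := by
  have h1 : 1 - cosDefect μ t = ∫ y, Real.cos (t * y) ∂μ := by
    rw [cosDefect, integral_sub (integrable_const 1) (integrable_cos t)]; simp
  have h2 : charFun μ t = (1 - cosDefect μ t : ℝ) + (sinMean μ t : ℝ) * Complex.I := by
    rw [h1, sinMean, ← integral_complex_ofReal, ← integral_complex_ofReal, ← integral_mul_const, ← integral_add
      (integrable_cos t).ofReal ((integrable_sin t).ofReal.mul_const _), charFun_apply_real]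
    refine integral_congr_ae (Eventually.of_forall fun y => ?_)
    simp only
    rw [← Complex.ofReal_mul, Complex.exp_ofReal_mul_I]
  rw [h2, ← Complex.normSq_eq_norm_sq, Complex.normSq_add_mul_I]

theorem sq_mul_truncMoment_le_cosDefect {t x : ℝ} (h : |t| * x ≤ 1) :
    t ^ 2 * truncMoment μ id 2 x ≤ 5 * cosDefect μ t := by
  rw [truncMoment_id, cosDefect, ← integral_const_mul, ← integral_const_mul]
  refine integral_mono ((integrable_truncated 2 x).const_mul _)
    ((integrable_one_sub_cos t).const_mul 5) fun y => ?_
  simp only [Set.indicator_apply, Set.mem_ofPred_eq]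
  have hc := Real.cos_le_one (t * y)
  split_ifs with hy
  · have h1 : |t * y| ≤ 1 := by
      rw [abs_mul]; exact (mul_le_mul_of_nonneg_left hy (abs_nonneg t)).trans h
    have h2 := Real.cos_le_one_sub_mul_cos_sq (h1.trans (by linarith [Real.pi_gt_three]))
    have h3 : 1 / 5 ≤ 2 / Real.pi ^ 2 := by
      rw [div_le_div_iff₀ (by norm_num) (by positivity)]
      nlinarith [Real.pi_lt_d2, Real.pi_pos]
    have h4 := mul_le_mul_of_nonneg_right h3 (sq_nonneg (t * y))
    rw [mul_pow] at h2 h4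
    linarith
  · linarith

theorem cosDefect_le (t x : ℝ) :
    cosDefect μ t ≤ t ^ 2 / 2 * truncMoment μ id 2 x + 2 * tailProb μ x := by
  rw [truncMoment_id, tailProb_eq_integral, cosDefect, ← integral_const_mul, ← integral_const_mul,
    ← integral_add ((integrable_truncated 2 x).const_mul _)
      ((integrable_tailIndicator x).const_mul _)]
  refine integral_mono (integrable_one_sub_cos t) (((integrable_truncated 2 x).const_mul _).add
      ((integrable_tailIndicator x).const_mul _)) fun y => ?_
  simp only [Set.indicator_apply, Set.mem_ofPred_eq]
  by_cases h : |y| ≤ x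
  · have := Real.one_sub_sq_div_two_le_cos (x := t * y)
    simp only [h, not_lt.2 h, if_true, if_false]
    linarith
  · have := Real.neg_one_le_cos (t * y)
    simp only [h, not_le.1 h, if_true, if_false]
    linarith

theorem measurable_cosDefect : Measurable (cosDefect μ) := by
  have : StronglyMeasurable (Function.uncurry fun t y : ℝ => 1 - Real.cos (t * y)) :=
    (by fun_prop : Continuous (Function.uncurry fun t y : ℝ => 1 - Real.cos (t * y))).stronglyMeasurable
  exact this.integral_prod_right.measurable

theorem tendsto_cosDefect_zero : Tendsto (cosDefect μ) (𝓝 0) (𝓝 0) := by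
  have h0 : cosDefect μ 0 = 0 := by simp [cosDefect]
  have : Continuous (cosDefect μ) := by
    refine continuous_of_dominated (bound := fun _ => 2) (fun t => by fun_prop) ?_
      (integrable_const _) (Eventually.of_forall fun y => by fun_prop)
    intro t
    refine Eventually.of_forall fun y => ?_
    rw [Real.norm_eq_abs, abs_le]
    constructor <;> linarith [Real.cos_le_one (t * y), Real.neg_one_le_cos (t * y)]
  simpa [h0] using this.tendsto 0

/-- For a centred, nondegenerate law, `1 - |χ(t)|² ~ 2 E(1 - cos tX)` as `t → 0`, where `χ` is the
characteristic function. This is what makes symmetrisation unnecessary. -/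
theorem tendsto_one_sub_normSq_div (hint : Integrable id μ) (hmean : ∫ y, y ∂μ = 0)
    (hnd : ∃ K > 0, 0 < truncMoment μ id 2 K) :
    (∀ᶠ t in 𝓝[≠] 0, 0 < cosDefect μ t) ∧
    Tendsto (fun t => (1 - ‖charFun μ t‖ ^ 2) / cosDefect μ t) (𝓝[≠] 0) (𝓝 2) := by
  obtain ⟨K, hK, hU⟩ := hnd
  have hlow : ∀ᶠ t in 𝓝[≠] (0 : ℝ), t ^ 2 * truncMoment μ id 2 K ≤ 5 * cosDefect μ t := by
    have : ∀ᶠ t in 𝓝 (0 : ℝ), |t| * K < 1 :=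
      (by fun_prop : Continuous fun t : ℝ => |t| * K).tendsto' 0 0 (by simp)
        |>.eventually (gt_mem_nhds one_pos)
    exact (this.filter_mono nhdsWithin_le_nhds).mono fun t ht =>
      sq_mul_truncMoment_le_cosDefect ht.le
  have hpos : ∀ᶠ t in 𝓝[≠] 0, 0 < cosDefect μ t := by
    filter_upwards [hlow, eventually_mem_nhdsWithin] with t ht ht0
    have : 0 < t ^ 2 := sq_pos_of_ne_zero ht0
    nlinarith [mul_pos this hU]
  refine ⟨hpos, ?_⟩
  have hB : Tendsto (fun t => sinMean μ t ^ 2 / cosDefect μ t) (𝓝[≠] 0) (𝓝 0) := by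
    have h1 : Tendsto (fun t => 5 / truncMoment μ id 2 K * (sinMean μ t / t) ^ 2) (𝓝[≠] 0) (𝓝 0) := by
      simpa using ((tendsto_sinMean_div hint hmean).pow 2).const_mul (5 / truncMoment μ id 2 K)
    refine tendsto_of_tendsto_of_tendsto_of_le_of_le' tendsto_const_nhds h1 ?_ ?_
    · exact Eventually.of_forall fun t => div_nonneg (sq_nonneg _) (cosDefect_nonneg t)
    · filter_upwards [hlow, hpos, eventually_mem_nhdsWithin] with t ht h0 ht0
      have ht0' : t ≠ 0 := ht0
      rw [div_le_iff₀ h0]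
      have : (sinMean μ t / t) ^ 2 * t ^ 2 = sinMean μ t ^ 2 := by field_simp
      rw [← this, mul_comm (5 / _), mul_assoc]
      refine mul_le_mul_of_nonneg_left ?_ (sq_nonneg _)
      rw [div_mul_eq_mul_div, le_div_iff₀ hU]
      exact ht
  have h2 : Tendsto (fun t => 2 - cosDefect μ t - sinMean μ t ^ 2 / cosDefect μ t) (𝓝[≠] 0)
      (𝓝 (2 - 0 - 0)) :=
    ((tendsto_const_nhds.sub (tendsto_cosDefect_zero.mono_left nhdsWithin_le_nhds)).sub hB)
  rw [sub_zero, sub_zero] at h2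
  refine h2.congr' ?_
  filter_upwards [hpos] with t ht
  rw [normSq_charFun]
  field_simp
  ring

end CosDefect

/-! ### Consequences of asymptotic normality for the characteristic function -/

section Attraction

variable {μ : Measure ℝ} [IsProbabilityMeasure μ]

theorem norm_charFun_map_normalizedSum (n : ℕ) (a c t : ℝ) :
    ‖charFun ((Measure.pi fun _ : Fin n => μ).map fun y => ((∑ i, y i) - a) / c) t‖
      = ‖charFun μ (t / c)‖ ^ n := by
  rw [charFun_apply_real, integral_map (by fun_prop) (by fun_prop)]
  have h : ∀ y : Fin n → ℝ, Complex.exp (t * (((∑ i, y i) - a) / c : ℝ) * Complex.I)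
      = Complex.exp ((-(t * a / c) : ℝ) * Complex.I)
        * ∏ i, Complex.exp ((t / c : ℝ) * (y i : ℝ) * Complex.I) := fun y => by
    rw [← Complex.exp_sum, ← Complex.exp_add, ← Finset.sum_mul, ← Finset.mul_sum]
    congr 1
    push_cast
    ring
  simp_rw [h]
  rw [integral_const_mul, norm_mul, Complex.norm_exp_ofReal_mul_I, one_mul,
    integral_fintype_prod_eq_prod (μ := fun _ : Fin n => μ)
      (fun _ y => Complex.exp ((t / c : ℝ) * (y : ℝ) * Complex.I)), norm_prod]
  simp [charFun_apply_real]

/-- If the laws `ν n` converge weakly to an integrable law, their characteristic functions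
stay away from `0` on a fixed interval: with `f(w) = min(2, η|w|)` bounded and continuous,
`|1 - χ(t)| ≤ E f(W)` for `|t| ≤ η`, and `E f(N) ≤ η E|N|`, for `N` with the limiting law, is small. -/
theorem exists_half_le_norm_charFun {ν : ℕ → ProbabilityMeasure ℝ} {γ : ProbabilityMeasure ℝ}
    (hγ : Integrable id (γ : Measure ℝ)) (hν : Tendsto ν atTop (𝓝 γ)) :
    ∃ η > 0, ∀ᶠ n in atTop, ∀ t, |t| ≤ η → 1 / 2 ≤ ‖charFun (ν n : Measure ℝ) t‖ := by
  set C : ℝ := ∫ w, |w| ∂(γ : Measure ℝ) with hC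
  have hC0 : 0 ≤ C := integral_nonneg fun w => abs_nonneg w
  set η : ℝ := 1 / (4 * (C + 1)) with hη
  have hη0 : 0 < η := by positivity
  have hηC : η * C < 1 / 2 := by
    rw [hη, div_mul_eq_mul_div, div_lt_div_iff₀ (by positivity) (by norm_num)]; linarith
  let f : BoundedContinuousFunction ℝ ℝ :=
    BoundedContinuousFunction.ofNormedAddCommGroup (fun w => min 2 (η * |w|)) (by fun_prop) 2
      (fun w => by
        have : 0 ≤ η * |w| := by positivity
        rw [Real.norm_eq_abs, abs_of_nonneg (le_min (by norm_num) this)]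
        exact min_le_left _ _)
  have hf := ProbabilityMeasure.tendsto_iff_forall_integral_tendsto.1 hν f
  have hfγ : ∫ w, f w ∂(γ : Measure ℝ) < 1 / 2 := by
    refine lt_of_le_of_lt ?_ hηC
    rw [hC, ← integral_const_mul]
    exact integral_mono (f.integrable _) (hγ.abs.const_mul η) fun w => min_le_right _ _
  refine ⟨η, hη0, (hf.eventually (gt_mem_nhds hfγ)).mono fun n hn t ht => ?_⟩
  have h1 : ‖1 - charFun (ν n : Measure ℝ) t‖ ≤ ∫ w, f w ∂(ν n : Measure ℝ) := by
    have hi : Integrable (fun w : ℝ => Complex.exp (t * w * Complex.I)) (ν n : Measure ℝ) :=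
      Integrable.of_bound (by fun_prop) 1 (Eventually.of_forall fun w => by
        rw [← Complex.ofReal_mul, Complex.norm_exp_ofReal_mul_I])
    have h2 : 1 - charFun (ν n : Measure ℝ) t
        = ∫ w, (1 - Complex.exp (t * w * Complex.I)) ∂(ν n : Measure ℝ) := by
      rw [integral_sub (integrable_const 1) hi, charFun_apply_real]; simp
    rw [h2]
    refine norm_integral_le_of_norm_le (f.integrable _) (Eventually.of_forall fun w => ?_)
    refine le_min ?_ ?_
    · refine (norm_sub_le _ _).trans ?_
      rw [← Complex.ofReal_mul, Complex.norm_exp_ofReal_mul_I]; norm_num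
    · rw [norm_sub_rev, ← Complex.ofReal_mul, mul_comm _ Complex.I]
      refine Real.norm_exp_I_mul_ofReal_sub_one_le.trans ?_
      rw [Real.norm_eq_abs, abs_mul]; gcongr
  have h3 : ‖(1 : ℂ)‖ ≤ ‖1 - charFun (ν n : Measure ℝ) t‖ + ‖charFun (ν n : Measure ℝ) t‖ := by
    simpa using norm_add_le (1 - charFun (ν n : Measure ℝ) t) (charFun (ν n : Measure ℝ) t)
  rw [norm_one] at h3
  linarith

theorem InNormalDomainOfAttraction.exists_charFun (h : InNormalDomainOfAttraction μ) :
    ∃ c : ℕ → ℝ, (∀ n, 0 < c n) ∧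
      (∀ t, Tendsto (fun n => (‖charFun μ (t / c n)‖ ^ 2) ^ n) atTop (𝓝 (Real.exp (-t ^ 2)))) ∧
      ∃ η > 0, ∀ᶠ n in atTop, ∀ t, |t| ≤ η → 1 / 4 ≤ (‖charFun μ (t / c n)‖ ^ 2) ^ n := by
  obtain ⟨a, c, hc, hd⟩ := h
  refine ⟨c, hc, fun t => ?_, ?_⟩
  · have h1 := (ProbabilityMeasure.tendsto_iff_tendsto_charFun.1 hd.tendsto t).norm.pow 2
    simp only [ProbabilityMeasure.coe_mk, norm_charFun_map_normalizedSum, Measure.map_id,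
      charFun_gaussianReal, Complex.norm_exp] at h1
    convert! h1 using 2
    · ring
    · rw [← Real.exp_nat_mul]
      congr 1
      simp [← Complex.ofReal_pow]
      ring
  · obtain ⟨η, hη, h1⟩ := exists_half_le_norm_charFun (by
      simpa using (memLp_id_gaussianReal (μ := 0) (v := 1) 1).integrable (by norm_num)) hd.tendsto
    refine ⟨η, hη, h1.mono fun n hn t ht => ?_⟩
    have h2 := hn t ht
    simp only [ProbabilityMeasure.coe_mk, norm_charFun_map_normalizedSum] at h2
    rw [← pow_mul, mul_comm, pow_mul]
    nlinarith

end Attraction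

/-! ### The converse central limit theorem: tails against truncated second moments -/

theorem natCast_mul_one_sub_le {p : ℝ} {n : ℕ} (hp : 0 ≤ p) (h : 1 / 4 ≤ p ^ n) :
    n * (1 - p) ≤ 2 := by
  rcases Nat.eq_zero_or_pos n with hn | hn
  · simp [hn]
  have hp0 : 0 < p := by
    rcases hp.eq_or_lt with h0 | h0
    · rw [← h0, zero_pow hn.ne'] at h; norm_num at h
    · exact h0
  have h1 : Real.log (1 / 4) ≤ n * Real.log p := by
    rw [← Real.log_pow]; exact Real.log_le_log (by norm_num) h
  have h2 : Real.log (1 / 4) = -(2 * Real.log 2) := by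
    rw [one_div, Real.log_inv, show (4 : ℝ) = 2 ^ 2 by norm_num, Real.log_pow]; norm_num
  have h3 := Real.log_two_lt_d9
  have h4 := mul_le_mul_of_nonneg_left (Real.log_le_sub_one_of_pos hp0) n.cast_nonneg
  linarith

theorem tendsto_natCast_mul_one_sub {p : ℕ → ℝ} {L : ℝ} (hp : ∀ n, 0 ≤ p n)
    (h : Tendsto (fun n => p n ^ n) atTop (𝓝 (Real.exp (-L)))) :
    Tendsto (fun n => n * (1 - p n)) atTop (𝓝 L) := by
  have hlog : Tendsto (fun n : ℕ => -(n * Real.log (p n))) atTop (𝓝 L) := by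
    have := (h.log (Real.exp_pos _).ne').neg
    simpa [Real.log_pow] using this
  have hpos : ∀ᶠ n in atTop, 0 < p n := by
    filter_upwards [h.eventually (lt_mem_nhds (Real.exp_pos _)), eventually_gt_atTop 0] with n hn h0
    refine (hp n).lt_of_ne fun h1 => ?_
    rw [← h1, zero_pow h0.ne'] at hn
    exact lt_irrefl _ hn
  have hlogp : Tendsto (fun n => Real.log (p n)) atTop (𝓝 0) := by
    have := (hlog.div_atTop tendsto_natCast_atTop_atTop).neg
    rw [neg_zero] at this
    refine this.congr' ?_
    filter_upwards [eventually_gt_atTop 0] with n hn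
    have : (n : ℝ) ≠ 0 := by exact_mod_cast hn.ne'
    field_simp
  have hp1 : Tendsto p atTop (𝓝 1) := by
    have := (Real.continuous_exp.tendsto 0).comp hlogp
    rw [Real.exp_zero] at this
    exact this.congr' (hpos.mono fun n hn => Real.exp_log hn)
  refine tendsto_of_tendsto_of_tendsto_of_le_of_le' (by simpa using hp1.mul hlog) hlog ?_ ?_
  · filter_upwards [hpos] with n hn
    have h1 := Real.one_sub_inv_le_log_of_pos hn
    have h2 : p n * (1 - (p n)⁻¹) ≤ p n * Real.log (p n) := by gcongr
    rw [mul_sub, mul_inv_cancel₀ hn.ne', mul_one] at h2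
    have h3 := mul_le_mul_of_nonneg_left h2 (Nat.cast_nonneg n : (0 : ℝ) ≤ n)
    linarith
  · filter_upwards [hpos] with n hn
    have h4 := mul_le_mul_of_nonneg_left (Real.log_le_sub_one_of_pos hn)
      (Nat.cast_nonneg n : (0 : ℝ) ≤ n)
    linarith

/-- The part of the characteristic-function information about `X` and the norming sequence `c` from
which the tail condition is derived. -/
structure CharFunScaling (μ : Measure ℝ) (c : ℕ → ℝ) (η : ℝ) : Prop where
  pos : ∀ n, 0 < c n
  eta_pos : 0 < η
  tendsto : ∀ t, Tendsto (fun n => (‖charFun μ (t / c n)‖ ^ 2) ^ n) atTop (𝓝 (Real.exp (-t ^ 2)))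
  bound : ∀ᶠ n in atTop, ∀ t, |t| ≤ η → 1 / 4 ≤ (‖charFun μ (t / c n)‖ ^ 2) ^ n

section Scaling

variable {μ : Measure ℝ} [IsProbabilityMeasure μ] {c : ℕ → ℝ} {η : ℝ}

/-- A law with a nontrivial characteristic function is not concentrated at the origin. -/
theorem CharFunScaling.nondegenerate (h : CharFunScaling μ c η) (hint : Integrable id μ) :
    ∃ K > 0, 0 < truncMoment μ id 2 K := by
  by_contra! hcon
  have hv : ∀ t, cosDefect μ t = 0 := by
    intro t
    refine le_antisymm ?_ (cosDefect_nonneg t)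
    have h1 : Tendsto (fun K => 2 * tailProb μ K) atTop (𝓝 (2 * 0)) :=
      (tendsto_tailProb hint).const_mul 2
    rw [mul_zero] at h1
    refine ge_of_tendsto h1 ?_
    filter_upwards [eventually_gt_atTop 0] with K hK
    have h2 := cosDefect_le (μ := μ) t K
    nlinarith [hcon K hK, sq_nonneg t]
  have h1 : Real.exp (-1 ^ 2) < 1 := by rw [Real.exp_lt_one_iff]; norm_num
  obtain ⟨n, hn⟩ := ((h.tendsto 1).eventually (gt_mem_nhds h1)).exists
  have h2 : 1 ≤ ‖charFun μ (1 / c n)‖ ^ 2 := by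
    rw [normSq_charFun, hv]; nlinarith [sq_nonneg (sinMean μ (1 / c n))]
  linarith [one_le_pow₀ h2 (n := n)]

theorem CharFunScaling.tendsto_atTop (h : CharFunScaling μ c η) (hint : Integrable id μ)
    (hmean : ∫ y, y ∂μ = 0) : Tendsto c atTop atTop := by
  obtain ⟨hpos, hdiv⟩ := tendsto_one_sub_normSq_div hint hmean (h.nondegenerate hint)
  have hh : ∀ᶠ t in 𝓝[≠] (0 : ℝ), 0 < 1 - ‖charFun μ t‖ ^ 2 := by
    filter_upwards [hpos, hdiv.eventually (lt_mem_nhds two_pos)] with t h1 h2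
    exact (div_pos_iff_of_pos_right h1).1 h2
  rw [eventually_nhdsWithin_iff, Metric.eventually_nhds_iff] at hh
  obtain ⟨r, hr, hh⟩ := hh
  refine Filter.tendsto_atTop.2 fun M => ?_
  -- a fixed point `s` at which the defect is positive and `c n * s ≤ η` as long as `c n ≤ M`
  set s := min (r / 2) (η / (|M| + 1)) with hs
  have hM : 0 < |M| + 1 := by positivity
  have hs0 : 0 < s := lt_min (by linarith) (div_pos h.eta_pos hM)
  have hd : 0 < 1 - ‖charFun μ s‖ ^ 2 := by
    refine hh ?_ hs0.ne'
    rw [Real.dist_eq, sub_zero, abs_of_pos hs0]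
    exact lt_of_le_of_lt (min_le_left _ _) (by linarith)
  have hn : ∀ᶠ n : ℕ in atTop, 2 < n * (1 - ‖charFun μ s‖ ^ 2) :=
    (tendsto_natCast_atTop_atTop.atTop_mul_const hd).eventually (eventually_gt_atTop 2)
  filter_upwards [hn, h.bound] with n h1 h2
  by_contra! hlt
  have hcs : |c n * s| ≤ η := by
    rw [abs_of_pos (mul_pos (h.pos n) hs0)]
    calc c n * s ≤ (|M| + 1) * (η / (|M| + 1)) := by
          gcongr
          · linarith [le_abs_self M]
          · exact min_le_right _ _
      _ = η := by field_simp
  have h3 := natCast_mul_one_sub_le (sq_nonneg _) (h2 _ hcs)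
  rw [mul_div_cancel_left₀ s (h.pos n).ne'] at h3
  linarith

/-- `n E(1 - cos(tX / c_n)) → t² / 2`, with a uniform bound near the origin. -/
theorem CharFunScaling.tendsto_cosDefect (h : CharFunScaling μ c η) (hint : Integrable id μ)
    (hmean : ∫ y, y ∂μ = 0) :
    (∀ t, Tendsto (fun n : ℕ => n * cosDefect μ (t / c n)) atTop (𝓝 (t ^ 2 / 2))) ∧
    ∀ᶠ n : ℕ in atTop, ∀ t, |t| ≤ η → n * cosDefect μ (t / c n) ≤ 2 := by
  obtain ⟨hpos, hdiv⟩ := tendsto_one_sub_normSq_div hint hmean (h.nondegenerate hint)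
  have hc := h.tendsto_atTop hint hmean
  have h0 : cosDefect μ 0 = 0 := by simp [cosDefect]
  constructor
  · intro t
    rcases eq_or_ne t 0 with rfl | ht
    · simp [h0]
    have ht0 : Tendsto (fun n => t / c n) atTop (𝓝[≠] 0) :=
      tendsto_nhdsWithin_iff.2 ⟨tendsto_const_nhds.div_atTop hc,
        Eventually.of_forall fun n => div_ne_zero ht (h.pos n).ne'⟩
    have h1 := tendsto_natCast_mul_one_sub (fun n => sq_nonneg ‖charFun μ (t / c n)‖) (h.tendsto t)
    have h2 := h1.div (hdiv.comp ht0) two_ne_zero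
    refine h2.congr' ?_
    filter_upwards [ht0.eventually hpos,
      (hdiv.comp ht0).eventually (lt_mem_nhds two_pos)] with n hn hn2
    simp only [Function.comp_apply] at hn2
    have h3 : 1 - ‖charFun μ (t / c n)‖ ^ 2 ≠ 0 := ((div_pos_iff_of_pos_right hn).1 hn2).ne'
    simp only [Pi.div_apply, Function.comp_apply]
    have h4 := hn.ne'
    field_simp
  · have hle : ∀ᶠ t in 𝓝[≠] (0 : ℝ), cosDefect μ t ≤ 1 - ‖charFun μ t‖ ^ 2 := by
      filter_upwards [hpos, hdiv.eventually (lt_mem_nhds one_lt_two)] with t h1 h2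
      rw [lt_div_iff₀ h1] at h2; linarith
    rw [eventually_nhdsWithin_iff, Metric.eventually_nhds_iff] at hle
    obtain ⟨r, hr, hle⟩ := hle
    filter_upwards [h.bound, hc.eventually (eventually_gt_atTop (η / r))] with n hn hcn t ht
    rcases eq_or_ne t 0 with rfl | ht0
    · simp [h0]
    refine le_trans ?_ (natCast_mul_one_sub_le (sq_nonneg _) (hn t ht))
    refine mul_le_mul_of_nonneg_left (hle ?_ (div_ne_zero ht0 (h.pos n).ne')) n.cast_nonneg
    rw [Real.dist_eq, sub_zero, abs_div, abs_of_pos (h.pos n), div_lt_iff₀ (h.pos n)]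
    have := (div_lt_iff₀ hr).1 hcn
    linarith

/-- The mean over `t ∈ [0, η]` of `(1 - cos tz)²` is at least `1/2` for `|z| ≥ 4 / η`. -/
theorem half_le_integral_one_sub_cos_sq {z : ℝ} (hη : 0 < η) (hz : 4 / η ≤ |z|) :
    η / 2 ≤ ∫ t in (0 : ℝ)..η, (1 - Real.cos (t * z)) ^ 2 := by
  have hz0 : 0 < |z| := lt_of_lt_of_le (by positivity) hz
  have hzne : z ≠ 0 := abs_pos.1 hz0
  have hd : ∀ t ∈ Set.uIcc 0 η, HasDerivAt
      (fun t => 3 / 2 * t - 2 * (Real.sin (t * z) / z) + Real.sin (2 * (t * z)) / (4 * z))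
      ((1 - Real.cos (t * z)) ^ 2) t := by
    intro t _
    have h1 := ((hasDerivAt_id t).mul_const z).sin
    have h2 := (((hasDerivAt_id t).mul_const z).const_mul 2).sin
    have h3 := (((hasDerivAt_id t).const_mul (3 / 2)).sub ((h1.div_const z).const_mul 2)).add
      (h2.div_const (4 * z))
    convert! h3 using 1
    simp only [id_eq, one_mul, mul_one]
    rw [Real.cos_two_mul]
    field_simp
    ring
  rw [intervalIntegral.integral_eq_sub_of_hasDerivAt hd
    (Continuous.intervalIntegrable (by fun_prop) _ _)]
  have hzi : 1 / |z| ≤ η / 4 := by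
    rw [div_le_div_iff₀ hz0 (by norm_num)]
    rw [div_le_iff₀ hη] at hz; linarith
  have b1 : |Real.sin (η * z) / z| ≤ η / 4 := by
    rw [abs_div]
    exact (div_le_div_of_nonneg_right (Real.abs_sin_le_one _) hz0.le).trans hzi
  have b2 : |Real.sin (2 * (η * z)) / (4 * z)| ≤ η / 16 := by
    rw [abs_div, abs_mul, abs_of_pos (by norm_num : (0 : ℝ) < 4)]
    calc _ ≤ 1 / (4 * |z|) := by gcongr; exact Real.abs_sin_le_one _
      _ = (1 / |z|) / 4 := by field_simp
      _ ≤ _ := by linarith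
  rw [abs_le] at b1 b2
  simp only [zero_mul, mul_zero, Real.sin_zero, zero_div]
  linarith [b1.2, b2.1]

/-- `n P(|X| > (4 / η) c_n) → 0`. Since `(1 - cos θ)² = 2 (1 - cos θ) - (1 - cos 2θ) / 2`, the limits
`t² / 2` of `n E(1 - cos(tX / c_n))` cancel in `n E(1 - cos(tX / c_n))²`; averaging over `t` turns
this into a statement on tails. -/
theorem CharFunScaling.tendsto_tail (h : CharFunScaling μ c η) (hint : Integrable id μ)
    (hmean : ∫ y, y ∂μ = 0) :
    Tendsto (fun n : ℕ => n * tailProb μ (4 / η * c n)) atTop (𝓝 0) := by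
  obtain ⟨hlim, hbd⟩ := h.tendsto_cosDefect hint hmean
  have hη := h.eta_pos
  set Q : ℝ → ℝ := fun t => ∫ y, (1 - Real.cos (t * y)) ^ 2 ∂μ with hQ
  have hQeq : ∀ t, Q t = 2 * cosDefect μ t - cosDefect μ (2 * t) / 2 := by
    intro t
    rw [cosDefect, cosDefect, ← integral_const_mul, ← integral_div, ← integral_sub
      ((integrable_one_sub_cos t).const_mul 2) ((integrable_one_sub_cos (2 * t)).div_const 2)]
    refine integral_congr_ae (Eventually.of_forall fun y => ?_)
    simp only
    rw [mul_assoc 2 t y, Real.cos_two_mul]; ring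
  have hQ0 : ∀ t, 0 ≤ Q t := fun t => integral_nonneg fun y => sq_nonneg _
  have hQlim : ∀ t, Tendsto (fun n : ℕ => n * Q (t / c n)) atTop (𝓝 0) := by
    intro t
    have h1 := ((hlim t).const_mul 2).sub ((hlim (2 * t)).div_const 2)
    convert! h1 using 2 with n
    · simp only [hQeq, mul_div_assoc]; ring
    · ring
  have hQint : Tendsto (fun n : ℕ => ∫ t in (0 : ℝ)..η, n * Q (t / c n)) atTop (𝓝 0) := by
    have := intervalIntegral.tendsto_integral_filter_of_dominated_convergence
      (F := fun (n : ℕ) t => n * Q (t / c n)) (f := fun _ => 0) (a := 0) (b := η) (μ := volume)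
      (l := atTop) (fun _ => 4) ?_ ?_ (by simp) (Eventually.of_forall fun t _ => hQlim t)
    · simpa using this
    · refine Eventually.of_forall fun n => Measurable.aestronglyMeasurable ?_
      have hm : Measurable Q := by
        have : Q = fun t => 2 * cosDefect μ t - cosDefect μ (2 * t) / 2 := funext hQeq
        rw [this]
        have := measurable_cosDefect (μ := μ)
        fun_prop
      fun_prop
    · filter_upwards [hbd] with n hn
      refine Eventually.of_forall fun t ht => ?_
      rw [Set.uIoc_of_le hη.le] at ht
      have h1 := hn t (by rw [abs_of_pos ht.1]; exact ht.2)
      have hn0 : (0 : ℝ) ≤ n := n.cast_nonneg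
      rw [Real.norm_eq_abs, abs_of_nonneg (mul_nonneg hn0 (hQ0 _)), hQeq]
      nlinarith [mul_nonneg hn0 (cosDefect_nonneg (μ := μ) (2 * (t / c n)))]
  have hlow : ∀ n : ℕ, n * tailProb μ (4 / η * c n) ≤
      2 / η * ∫ t in (0 : ℝ)..η, n * Q (t / c n) := by
    intro n
    have hcn := h.pos n
    have hswap : ∫ t in (0 : ℝ)..η, Q (t / c n)
        = ∫ y, (∫ t in (0 : ℝ)..η, (1 - Real.cos (t * (y / c n))) ^ 2) ∂μ := by
      have : IsFiniteMeasure (volume.restrict (Set.uIoc 0 η)) := ⟨by simp [Set.uIoc_of_le hη.le]⟩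
      have hb : Integrable (Function.uncurry fun t y => (1 - Real.cos (t * (y / c n))) ^ 2)
          ((volume.restrict (Set.uIoc 0 η)).prod μ) := by
        refine Integrable.of_bound (Continuous.aestronglyMeasurable (by fun_prop)) 4
          (Eventually.of_forall fun z => ?_)
        have h1 := Real.cos_le_one (z.1 * (z.2 / c n))
        have h2 := Real.neg_one_le_cos (z.1 * (z.2 / c n))
        simp only [Function.uncurry, Real.norm_eq_abs, abs_sq]
        nlinarith
      rw [← intervalIntegral_integral_swap hb]
      refine intervalIntegral.integral_congr fun t _ => ?_
      simp only [hQ]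
      refine integral_congr_ae (Eventually.of_forall fun y => ?_)
      simp only
      congr 3; ring
    rw [intervalIntegral.integral_const_mul, hswap, tailProb_eq_integral]
    have h1 : η / 2 * ∫ y, {y : ℝ | 4 / η * c n < |y|}.indicator (fun _ => (1 : ℝ)) y ∂μ
        ≤ ∫ y, (∫ t in (0 : ℝ)..η, (1 - Real.cos (t * (y / c n))) ^ 2) ∂μ := by
      rw [← integral_const_mul]
      refine integral_mono ((integrable_tailIndicator _).const_mul _) ?_ fun y => ?_
      · refine Integrable.of_bound ?_ (4 * |η - 0|) (Eventually.of_forall fun y => ?_)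
        · refine (intervalIntegral.continuous_parametric_intervalIntegral_of_continuous'
            ?_ 0 η).aestronglyMeasurable
          fun_prop
        · refine intervalIntegral.norm_integral_le_of_norm_le_const fun t _ => ?_
          have h1 := Real.cos_le_one (t * (y / c n))
          have h2 := Real.neg_one_le_cos (t * (y / c n))
          simp only [Real.norm_eq_abs, abs_sq]
          nlinarith
      · simp only [Set.indicator_apply, Set.mem_ofPred_eq]
        split_ifs with hy
        · rw [mul_one]
          refine half_le_integral_one_sub_cos_sq hη ?_
          rw [abs_div, abs_of_pos hcn, le_div_iff₀ hcn]; exact hy.le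
        · rw [mul_zero]
          exact intervalIntegral.integral_nonneg hη.le fun t _ => sq_nonneg _
    have h2 := mul_le_mul_of_nonneg_left h1 (by positivity : 0 ≤ 2 / η * (n : ℝ))
    calc _ = 2 / η * n * (η / 2 * ∫ y, {y : ℝ | 4 / η * c n < |y|}.indicator
          (fun _ => (1 : ℝ)) y ∂μ) := by field_simp
      _ ≤ _ := h2
      _ = _ := by ring
  refine tendsto_of_tendsto_of_tendsto_of_le_of_le tendsto_const_nhds
    (by simpa using hQint.const_mul (2 / η)) (fun n => ?_) hlow
  exact mul_nonneg n.cast_nonneg (tailProb_nonneg _)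

end Scaling

/-- The tail condition `x² P(|X| > x) = o(E[X² I(|X| ≤ x)])` as `x → ∞`. -/
def TailNegligible (μ : Measure ℝ) : Prop :=
  ∀ ε > 0, ∃ K > 0, ∀ x ≥ K, x ^ 2 * tailProb μ x ≤ ε * truncMoment μ id 2 x

theorem integrable_absTail {μ : Measure ℝ} (hint : Integrable id μ) (x : ℝ) :
    Integrable ({y : ℝ | x < |y|}.indicator fun y => |y|) μ :=
  hint.abs.indicator (measurableSet_lt_abs x)

theorem tendsto_integral_absTail {μ : Measure ℝ} (hint : Integrable id μ) :
    Tendsto (fun x : ℝ => ∫ y, {y : ℝ | x < |y|}.indicator (fun y => |y|) y ∂μ) atTop (𝓝 0) := by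
  rw [show (0 : ℝ) = ∫ _, (0 : ℝ) ∂μ by simp]
  refine tendsto_integral_filter_of_dominated_convergence (fun y => |y|)
    (Eventually.of_forall fun x => (integrable_absTail hint x).aestronglyMeasurable)
    (Eventually.of_forall fun x => Eventually.of_forall fun y => ?_) hint.abs
    (Eventually.of_forall fun y => ?_)
  · simp only [Set.indicator_apply, Set.mem_ofPred_eq]
    split_ifs <;> simp
  · refine tendsto_const_nhds.congr' ?_
    filter_upwards [eventually_ge_atTop |y|] with x hx
    simp [not_lt.2 hx]

section TailCondition

variable {μ : Measure ℝ} [IsProbabilityMeasure μ] {c : ℕ → ℝ} {η : ℝ}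

/-- Along `x_n = (4 / η) c_n` the tail condition follows from `n P(|X| > x_n) → 0` and
`n E[X² I(|X| ≤ x_n)] ≥ c_n² / 2`; it extends to all `x` because `c_{n+1} / c_n` is bounded. -/
theorem CharFunScaling.tailNegligible (h : CharFunScaling μ c η) (hint : Integrable id μ)
    (hmean : ∫ y, y ∂μ = 0) : TailNegligible μ := by
  obtain ⟨hlim, hbd⟩ := h.tendsto_cosDefect hint hmean
  have htail := h.tendsto_tail hint hmean
  have hc := h.tendsto_atTop hint hmean
  have hη := h.eta_pos
  set l : ℝ := 4 / η with hl
  have hl0 : 0 < l := by positivity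
  set U := truncMoment μ id 2 with hU
  set T := tailProb μ with hT
  have hlim1 : ∀ᶠ n : ℕ in atTop, 3 / 8 < n * cosDefect μ (1 / c n) :=
    (hlim 1).eventually (lt_mem_nhds (by norm_num))
  have hT16 : ∀ᶠ n : ℕ in atTop, n * T (l * c n) < 1 / 32 :=
    htail.eventually (gt_mem_nhds (by norm_num))
  have hlow : ∀ᶠ n : ℕ in atTop, c n ^ 2 / 2 ≤ n * U (l * c n) := by
    filter_upwards [hlim1, hT16] with n h1 h2
    have hcn := h.pos n
    have h3 := mul_le_mul_of_nonneg_left (cosDefect_le (μ := μ) (1 / c n) (l * c n))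
      (Nat.cast_nonneg n : (0 : ℝ) ≤ n)
    have h4 : 1 / 2 ≤ n * U (l * c n) / c n ^ 2 := by
      have : (n : ℝ) * ((1 / c n) ^ 2 / 2 * U (l * c n) + 2 * T (l * c n))
          = (n * U (l * c n) / c n ^ 2) / 2 + 2 * (n * T (l * c n)) := by field_simp
      rw [this] at h3
      linarith
    rw [le_div_iff₀ (by positivity)] at h4
    linarith
  have hupp : ∀ᶠ n : ℕ in atTop, n * U (l * c n) ≤ 10 * (l * c n) ^ 2 := by
    filter_upwards [hbd] with n hn
    have hcn := h.pos n
    have h1 := hn (1 / l) (by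
      rw [abs_of_pos (by positivity), hl, one_div_div]; linarith)
    have h2 := sq_mul_truncMoment_le_cosDefect (μ := μ) (t := 1 / l / c n) (x := l * c n) (by
      rw [abs_of_pos (by positivity)]; apply le_of_eq; field_simp)
    have h3 := mul_le_mul_of_nonneg_left h2 (Nat.cast_nonneg n : (0 : ℝ) ≤ n)
    have h4 : (n : ℝ) * U (l * c n) / (l * c n) ^ 2 ≤ 10 := by
      have : (n : ℝ) * U (l * c n) / (l * c n) ^ 2 = n * ((1 / l / c n) ^ 2 * U (l * c n)) := by
        field_simp
      rw [this]; linarith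
    rwa [div_le_iff₀ (by positivity)] at h4
  have hratio : ∀ᶠ n : ℕ in atTop, c (n + 1) ^ 2 ≤ 80 * l ^ 2 * c n ^ 2 := by
    filter_upwards [(tendsto_add_atTop_nat 1).eventually hlim1, hT16, hupp,
      eventually_ge_atTop 1] with n h1 h2 h3 hn1
    have hcn := h.pos (n + 1)
    have hn1' : (1 : ℝ) ≤ n := by exact_mod_cast hn1
    have h4 := cosDefect_le (μ := μ) (1 / c (n + 1)) (l * c n)
    have h5 := cosDefect_nonneg (μ := μ) (1 / c (n + 1))
    push_cast at h1
    have h6 : (n + 1) * cosDefect μ (1 / c (n + 1)) ≤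
        2 * n * ((1 / c (n + 1)) ^ 2 / 2 * U (l * c n) + 2 * T (l * c n)) :=
      mul_le_mul (by linarith) h4 h5 (by positivity)
    have h7 : 2 * (n : ℝ) * ((1 / c (n + 1)) ^ 2 / 2 * U (l * c n) + 2 * T (l * c n))
        = n * U (l * c n) / c (n + 1) ^ 2 + 4 * (n * T (l * c n)) := by field_simp; ring
    have h8 : 1 / 8 ≤ n * U (l * c n) / c (n + 1) ^ 2 := by linarith
    rw [le_div_iff₀ (by positivity)] at h8
    rw [mul_pow] at h3
    linarith
  intro ε hε
  set ε' := ε / (160 * l ^ 4) with hε'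
  have hε'0 : 0 < ε' := by positivity
  have hTε : ∀ᶠ n : ℕ in atTop, n * T (l * c n) < ε' := htail.eventually (gt_mem_nhds hε'0)
  obtain ⟨N, hN⟩ := eventually_atTop.1
    (hlow.and (hratio.and (hTε.and (eventually_ge_atTop 1))))
  refine ⟨l * c N, mul_pos hl0 (h.pos N), fun x hx => ?_⟩
  have hex : ∃ m, N ≤ m ∧ x < l * c m :=
    ((eventually_ge_atTop N).and
      ((hc.const_mul_atTop hl0).eventually (eventually_gt_atTop x))).exists
  classical
  -- consecutive indices with `x_n ≤ x < x_{n+1}`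
  obtain ⟨n, hnN, hn1, hn2⟩ : ∃ n, N ≤ n ∧ l * c n ≤ x ∧ x < l * c (n + 1) := by
    obtain ⟨h1, h2⟩ := Nat.find_spec hex
    have h3 : Nat.find hex ≠ N := fun h => by rw [h] at h2; linarith
    obtain ⟨n, hn⟩ : ∃ n, Nat.find hex = n + 1 := ⟨Nat.find hex - 1, by omega⟩
    have h5 := Nat.find_min hex (m := n) (by omega)
    rw [hn] at h2
    exact ⟨n, by omega, not_lt.1 fun h => h5 ⟨by omega, h⟩, h2⟩
  obtain ⟨g1, g2, g3, g4⟩ := hN n hnN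
  have hn0 : (0 : ℝ) < n := by exact_mod_cast g4
  have hcn := h.pos n
  have hx0 : 0 < x := lt_of_lt_of_le (by positivity) hn1
  refine le_of_mul_le_mul_left ?_ hn0
  calc n * (x ^ 2 * T x) = x ^ 2 * (n * T x) := by ring
    _ ≤ (l * c (n + 1)) ^ 2 * (n * T (l * c n)) := by
      have := tailProb_anti (μ := μ) hn1
      have h0 : 0 ≤ T x := tailProb_nonneg x
      gcongr
    _ ≤ (l * c (n + 1)) ^ 2 * ε' := by gcongr
    _ = l ^ 2 * c (n + 1) ^ 2 * ε' := by ring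
    _ ≤ l ^ 2 * (80 * l ^ 2 * c n ^ 2) * ε' := by gcongr
    _ = ε * (c n ^ 2 / 2) := by rw [hε']; field_simp; ring
    _ ≤ ε * (n * U (l * c n)) := by gcongr
    _ ≤ ε * (n * U x) := by gcongr; exact truncMoment_mono even_two hn1
    _ = n * (ε * U x) := by ring

/-- A centred law in the domain of attraction of the normal law satisfies the tail condition, and
is not concentrated at the origin. -/
theorem InNormalDomainOfAttraction.tailNegligible (h : InNormalDomainOfAttraction μ)
    (hint : Integrable id μ) (hmean : ∫ y, y ∂μ = 0) :
    TailNegligible μ ∧ ∃ K > 0, 0 < truncMoment μ id 2 K := by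
  obtain ⟨c, hc, hlim, η, hη, hbd⟩ := h.exists_charFun
  have hs : CharFunScaling μ c η := ⟨hc, hη, hlim, hbd⟩
  exact ⟨hs.tailNegligible hint hmean, hs.nondegenerate hint⟩

/-! ### Consequences of the tail condition for the other truncated moments -/

theorem truncMoment_four_le (x : ℝ) :
    truncMoment μ id 4 x ≤ x ^ 2 * truncMoment μ id 2 x := by
  rw [truncMoment_id, truncMoment_id, ← integral_const_mul]
  refine integral_mono (integrable_truncated 4 x) ((integrable_truncated 2 x).const_mul _)
    fun y => ?_
  simp only [Set.indicator_apply, Set.mem_ofPred_eq]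
  split_ifs with h
  · have : y ^ 2 ≤ x ^ 2 := sq_le_sq' (by linarith [neg_abs_le y]) ((le_abs_self y).trans h)
    nlinarith [sq_nonneg y]
  · simp

theorem TailNegligible.truncMoment_four (h : TailNegligible μ) :
    ∀ ε > 0, ∃ K > 0, ∀ x ≥ K, truncMoment μ id 4 x ≤ ε * (x ^ 2 * truncMoment μ id 2 x) := by
  intro ε hε
  -- truncate first at the level `l x`, with `l² ≤ ε / 2`
  set l : ℝ := √(min 1 (ε / 2)) with hl
  have hm : 0 < min 1 (ε / 2) := lt_min one_pos (by linarith)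
  have hl0 : 0 < l := Real.sqrt_pos.2 hm
  have hl2 : l ^ 2 = min 1 (ε / 2) := Real.sq_sqrt hm.le
  have hl2' : l ^ 2 ≤ ε / 2 := hl2 ▸ min_le_right _ _
  have hl1 : l ≤ 1 := by
    have : l ^ 2 ≤ 1 := hl2 ▸ min_le_left _ _
    nlinarith
  obtain ⟨K, hK, hT⟩ := h (l ^ 4) (by positivity)
  refine ⟨K / l, by positivity, fun x hx => ?_⟩
  have hx0 : 0 < x := lt_of_lt_of_le (by positivity) hx
  have hlx : l * x ≤ x := by nlinarith
  have h1 := truncMoment_le_add (μ := μ) (k := 4) (by decide) hlx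
  have h2 := truncMoment_four_le (μ := μ) (l * x)
  have h3 := hT (l * x) (by rw [ge_iff_le, div_le_iff₀ hl0] at hx; linarith)
  have h4 := truncMoment_mono (μ := μ) even_two hlx
  set U := truncMoment μ id 2
  have hU0 : 0 ≤ U x := truncMoment_nonneg even_two x
  have h5 : x ^ 4 * tailProb μ (l * x) ≤ l ^ 2 * (x ^ 2 * U x) := by
    have hl2p : 0 < l ^ 2 := by positivity
    refine le_of_mul_le_mul_left ?_ hl2p
    calc l ^ 2 * (x ^ 4 * tailProb μ (l * x)) = x ^ 2 * ((l * x) ^ 2 * tailProb μ (l * x)) := by ring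
      _ ≤ x ^ 2 * (l ^ 4 * U (l * x)) := by gcongr
      _ ≤ x ^ 2 * (l ^ 4 * U x) := by gcongr
      _ = _ := by ring
  have h6 : (l * x) ^ 2 * U (l * x) ≤ l ^ 2 * (x ^ 2 * U x) := by
    rw [mul_pow, mul_assoc]; gcongr
  have h7 : l ^ 2 * (x ^ 2 * U x) ≤ ε / 2 * (x ^ 2 * U x) := by gcongr
  linarith

theorem abs_truncMoment_three_le {θ x : ℝ} (hθ : 0 < θ) (hx : 0 < x) :
    |truncMoment μ id 3 x| ≤ θ * x * truncMoment μ id 2 x + truncMoment μ id 4 x / (θ * x) := by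
  rw [truncMoment_id, truncMoment_id, truncMoment_id, ← integral_const_mul, ← integral_div,
    ← integral_add ((integrable_truncated 2 x).const_mul _) ((integrable_truncated 4 x).div_const _)]
  refine abs_integral_le_integral_abs.trans ?_
  refine integral_mono (integrable_truncated 3 x).abs
    (((integrable_truncated 2 x).const_mul _).add ((integrable_truncated 4 x).div_const _))
    fun y => ?_
  simp only [Set.indicator_apply, Set.mem_ofPred_eq]
  split_ifs with h
  · set a := θ * x with ha
    have ha0 : 0 < a := mul_pos hθ hx
    rw [abs_pow, ← sq_abs y, ← Even.pow_abs (by decide : Even 4) y]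
    have : 0 ≤ |y| := abs_nonneg y
    have h1 : |y| ^ 3 * a ≤ a * |y| ^ 2 * a + |y| ^ 4 := by
      nlinarith [mul_nonneg (sq_nonneg |y|) (sq_nonneg (|y| - a)), mul_nonneg (sq_nonneg |y|) (mul_nonneg this ha0.le)]
    have h2 : a * |y| ^ 2 + |y| ^ 4 / a = (a * |y| ^ 2 * a + |y| ^ 4) / a := by field_simp
    rw [h2, le_div_iff₀ ha0]
    exact h1
  · simp

theorem TailNegligible.truncMoment_three (h : TailNegligible μ) :
    ∀ ε > 0, ∃ K > 0, ∀ x ≥ K, |truncMoment μ id 3 x| ≤ ε * (x * truncMoment μ id 2 x) := by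
  intro ε hε
  obtain ⟨K, hK, h4⟩ := h.truncMoment_four ((ε / 2) ^ 2) (by positivity)
  refine ⟨K, hK, fun x hx => ?_⟩
  have hx0 : 0 < x := lt_of_lt_of_le hK hx
  refine (abs_truncMoment_three_le (half_pos hε) hx0).trans ?_
  have : truncMoment μ id 4 x / (ε / 2 * x) ≤ ε / 2 * (x * truncMoment μ id 2 x) := by
    rw [div_le_iff₀ (by positivity)]
    refine (h4 x hx).trans (le_of_eq (by ring))
  linarith

/-- For a centred variable the truncated mean is controlled by the truncated tail of `E|X|`. -/
theorem abs_truncMoment_one_le (hint : Integrable id μ) (hmean : ∫ y, y ∂μ = 0) (x : ℝ) :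
    |truncMoment μ id 1 x| ≤ ∫ y, {y : ℝ | x < |y|}.indicator (fun y => |y|) y ∂μ := by
  have h : truncMoment μ id 1 x = ∫ y, ({y : ℝ | |y| ≤ x}.indicator (fun y => y ^ 1) y - y) ∂μ := by
    rw [integral_sub (g := fun y => y) (integrable_truncated 1 x) hint, hmean, sub_zero, truncMoment_id]
  rw [h]
  refine abs_integral_le_integral_abs.trans
    (integral_mono ((integrable_truncated 1 x).sub hint).abs (integrable_absTail hint x) fun y => ?_)
  simp only [Set.indicator_apply, Set.mem_ofPred_eq]
  by_cases hy : |y| ≤ x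
  · simp [hy, not_lt.2 hy]
  · simp [hy, not_le.1 hy]

theorem integral_absTail_le (hint : Integrable id μ) {x : ℝ} (hx : 0 ≤ x) :
    ∫ y, {y : ℝ | x < |y|}.indicator (fun y => |y|) y ∂μ ≤
      2 * x * tailProb μ x + ∫ y, {y : ℝ | 2 * x < |y|}.indicator (fun y => |y|) y ∂μ := by
  rw [tailProb_eq_integral, ← integral_const_mul,
    ← integral_add ((integrable_tailIndicator x).const_mul _) (integrable_absTail hint _)]
  refine integral_mono (integrable_absTail hint x)
    (((integrable_tailIndicator x).const_mul _).add (integrable_absTail hint _)) fun y => ?_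
  simp only [Set.indicator_apply, Set.mem_ofPred_eq]
  have := abs_nonneg y
  split_ifs with h1 h2 h2 <;> linarith

theorem TailNegligible.truncMoment_one (h : TailNegligible μ) (hint : Integrable id μ)
    (hmean : ∫ y, y ∂μ = 0) :
    ∀ ε > 0, ∃ K > 0, ∀ x ≥ K, |truncMoment μ id 1 x| * x ≤ ε * truncMoment μ id 2 x := by
  intro ε hε
  set e := min (1 / 8) (ε / 8) with he
  have he0 : 0 < e := lt_min (by norm_num) (by linarith)
  obtain ⟨K, hK, hT⟩ := h e he0
  set U := truncMoment μ id 2 with hU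
  set R : ℝ → ℝ := fun x => ∫ y, {y : ℝ | x < |y|}.indicator (fun y => |y|) y ∂μ with hR
  -- doubling the level multiplies `U` by at most `3 / 2`, so the dyadic blocks sum geometrically
  have hdouble : ∀ x ≥ K, U (2 * x) ≤ 3 / 2 * U x := by
    intro x hx
    have hx0 : 0 < x := lt_of_lt_of_le hK hx
    have h1 := truncMoment_le_add (μ := μ) even_two (by linarith : x ≤ 2 * x)
    have h2 := hT x hx
    have h3 : e * U x ≤ 1 / 8 * U x :=
      mul_le_mul_of_nonneg_right (min_le_left _ _) (truncMoment_nonneg even_two x)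
    rw [mul_pow] at h1
    linarith
  have hind : ∀ N : ℕ, ∀ x ≥ K, R x ≤ 8 * e * U x / x + R (2 ^ N * x) := by
    intro N
    induction N with
    | zero =>
      intro x hx
      have hx0 : 0 < x := lt_of_lt_of_le hK hx
      have : 0 ≤ U x := truncMoment_nonneg even_two x
      have : 0 ≤ 8 * e * U x / x := by positivity
      simpa using this
    | succ N ih =>
      intro x hx
      have hx0 : 0 < x := lt_of_lt_of_le hK hx
      have h1 := integral_absTail_le hint hx0.le
      have h2 := ih (2 * x) (by linarith)
      rw [show 2 ^ (N + 1) * x = 2 ^ N * (2 * x) by ring]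
      have h3 : 2 * x * tailProb μ x ≤ 2 * e * U x / x := by
        rw [le_div_iff₀ hx0]; linarith [hT x hx]
      have h4 : 8 * e * U (2 * x) / (2 * x) ≤ 6 * e * U x / x := by
        rw [div_le_div_iff₀ (by positivity) hx0]
        have := mul_le_mul_of_nonneg_left (hdouble x hx) (by positivity : 0 ≤ 8 * e * x)
        linarith
      have h5 : 8 * e * U x / x = 2 * e * U x / x + 6 * e * U x / x := by ring
      simp only [hR] at h2 ⊢
      linarith
  refine ⟨K, hK, fun x hx => ?_⟩
  have hx0 : 0 < x := lt_of_lt_of_le hK hx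
  have hRx : R x ≤ 8 * e * U x / x := by
    have h1 : Tendsto (fun N : ℕ => 8 * e * U x / x + R (2 ^ N * x)) atTop
        (𝓝 (8 * e * U x / x + 0)) :=
      tendsto_const_nhds.add ((tendsto_integral_absTail hint).comp
        ((tendsto_pow_atTop_atTop_of_one_lt one_lt_two).atTop_mul_const hx0))
    rw [add_zero] at h1
    exact ge_of_tendsto' h1 fun N => hind N x hx
  calc |truncMoment μ id 1 x| * x ≤ R x * x := by
        gcongr; exact abs_truncMoment_one_le hint hmean x
    _ ≤ 8 * e * U x / x * x := by gcongr
    _ = 8 * e * U x := by field_simp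
    _ ≤ ε * U x := by
      have := min_le_right (1 / 8 : ℝ) (ε / 8)
      exact mul_le_mul_of_nonneg_right (by linarith) (truncMoment_nonneg even_two x)

end TailCondition

/-! ### The scale `b_n` -/

section Scale

variable {μ : Measure ℝ}

theorem mem_scaleSet_iff {n : ℕ} {x : ℝ} :
    1 ≤ (n : ℝ) * (x ^ 2)⁻¹ * truncMoment μ id 2 x ↔
      0 < x ∧ x ^ 2 ≤ n * truncMoment μ id 2 x := by
  have hneg : x ≤ 0 → (n : ℝ) * (x ^ 2)⁻¹ * truncMoment μ id 2 x = 0 := by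
    intro hx
    rcases hx.eq_or_lt with rfl | hx
    · simp
    · have : truncMoment μ id 2 x = 0 := by
        rw [truncMoment_id]
        have : {y : ℝ | |y| ≤ x} = ∅ := by
          ext y
          simpa using lt_of_lt_of_le hx (abs_nonneg y)
        simp [this]
      rw [this, mul_zero]
  rcases le_or_gt x 0 with hx | hx
  · rw [hneg hx]
    constructor
    · intro h; norm_num at h
    · intro h; exact absurd h.1 (not_lt.2 hx)
  · rw [mul_right_comm, ← div_eq_mul_inv, le_div_iff₀ (by positivity), one_mul]
    simp [hx]

theorem rate_eq (n : ℕ) :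
    rate μ id n = n * tailProb μ (scale μ id n)
      + n * (scale μ id n)⁻¹ * |truncMoment μ id 1 (scale μ id n)|
      + n * (scale μ id n ^ 3)⁻¹ * |truncMoment μ id 3 (scale μ id n)|
      + n * (scale μ id n ^ 4)⁻¹ * truncMoment μ id 4 (scale μ id n) := rfl

variable [IsProbabilityMeasure μ]

/-- If `x` is in the set defining `b_n` then `x ≤ b_n`, and `n E[X² I(|X| ≤ b_n)] = b_n²`. -/
theorem scale_spec (hint : Integrable id μ) {n : ℕ} {x : ℝ} (hx : 0 < x)
    (h : x ^ 2 ≤ n * truncMoment μ id 2 x) :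
    x ≤ scale μ id n ∧ n * truncMoment μ id 2 (scale μ id n) = scale μ id n ^ 2 := by
  set U := truncMoment μ id 2 with hU
  set S := {x : ℝ | 1 ≤ (n : ℝ) * (x ^ 2)⁻¹ * U x} with hS
  have hmem : ∀ z, z ∈ S ↔ 0 < z ∧ z ^ 2 ≤ n * U z := fun z => mem_scaleSet_iff
  have hbdd : BddAbove S := by
    refine ⟨n * ∫ y, |y| ∂μ, fun z hz => ?_⟩
    obtain ⟨h0, h1⟩ := (hmem z).1 hz
    have h2 := mul_le_mul_of_nonneg_left (truncMoment_two_le hint h0.le)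
      (Nat.cast_nonneg n : (0 : ℝ) ≤ n)
    refine le_of_mul_le_mul_left ?_ h0
    linarith
  have hxS : x ∈ S := (hmem x).2 ⟨hx, h⟩
  have hb : scale μ id n = sSup S := rfl
  rw [hb]
  have hxb : x ≤ sSup S := le_csSup hbdd hxS
  refine ⟨hxb, le_antisymm ?_ ?_⟩
  · -- above `b_n` the defining inequality fails
    have hlim : Tendsto (fun z : ℝ => z ^ 2) (𝓝[>] (sSup S)) (𝓝 (sSup S ^ 2)) :=
      (by fun_prop : Continuous fun z : ℝ => z ^ 2).continuousWithinAt
    refine ge_of_tendsto hlim (eventually_mem_nhdsWithin.mono fun z hz => ?_)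
    have hz' : sSup S < z := hz
    have h1 : z ∉ S := fun hzS => absurd (le_csSup hbdd hzS) (not_le.2 hz')
    rw [hmem] at h1
    push Not at h1
    have h2 := h1 (by linarith)
    have h3 := mul_le_mul_of_nonneg_left (truncMoment_mono (μ := μ) even_two hz'.le)
      (Nat.cast_nonneg n : (0 : ℝ) ≤ n)
    exact h3.trans h2.le
  · have h1 : sSup S ≤ √(n * U (sSup S)) := by
      refine csSup_le ⟨x, hxS⟩ fun z hz => ?_
      obtain ⟨h0, h2⟩ := (hmem z).1 hz
      refine Real.le_sqrt_of_sq_le (h2.trans ?_)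
      exact mul_le_mul_of_nonneg_left (truncMoment_mono even_two (le_csSup hbdd hz))
        n.cast_nonneg
    have h0 : 0 ≤ (n : ℝ) * U (sSup S) :=
      mul_nonneg n.cast_nonneg (truncMoment_nonneg even_two _)
    calc sSup S ^ 2 ≤ √(n * U (sSup S)) ^ 2 := by gcongr; linarith
      _ = _ := Real.sq_sqrt h0

theorem eventually_scale (hint : Integrable id μ) (hnd : ∃ K > 0, 0 < truncMoment μ id 2 K) :
    Tendsto (scale μ id) atTop atTop ∧
      ∀ᶠ n : ℕ in atTop, n * truncMoment μ id 2 (scale μ id n) = scale μ id n ^ 2 := by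
  obtain ⟨K, hK, hU⟩ := hnd
  have key : ∀ x ≥ K, ∀ᶠ n : ℕ in atTop, x ^ 2 ≤ n * truncMoment μ id 2 x := by
    intro x hx
    have : 0 < truncMoment μ id 2 x := hU.trans_le (truncMoment_mono even_two hx)
    exact (tendsto_natCast_atTop_atTop.atTop_mul_const this).eventually
      (eventually_ge_atTop (x ^ 2))
  refine ⟨tendsto_atTop.2 fun M => ?_, ?_⟩
  · filter_upwards [key (max M K) (le_max_right _ _)] with n hn
    exact (le_max_left _ _).trans (scale_spec hint (hK.trans_le (le_max_right _ _)) hn).1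
  · filter_upwards [key K le_rfl] with n hn
    exact (scale_spec hint hK hn).2

/-- `δ_n → 0`. -/
theorem TailNegligible.tendsto_rate (h : TailNegligible μ) (hint : Integrable id μ)
    (hmean : ∫ y, y ∂μ = 0) (hnd : ∃ K > 0, 0 < truncMoment μ id 2 K) :
    Tendsto (rate μ id) atTop (𝓝 0) := by
  obtain ⟨hb, heq⟩ := eventually_scale hint hnd
  have key : ∀ ε > 0, ∀ᶠ n in atTop, rate μ id n ≤ 4 * ε := by
    intro ε hε
    obtain ⟨K0, _, h0⟩ := h ε hε
    obtain ⟨K1, _, h1⟩ := h.truncMoment_one hint hmean ε hε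
    obtain ⟨K3, _, h3⟩ := h.truncMoment_three ε hε
    obtain ⟨K4, _, h4⟩ := h.truncMoment_four ε hε
    filter_upwards [heq, hb.eventually (eventually_gt_atTop 0), hb.eventually (eventually_ge_atTop K0),
      hb.eventually (eventually_ge_atTop K1), hb.eventually (eventually_ge_atTop K3),
      hb.eventually (eventually_ge_atTop K4)] with n hn hb0 hk0 hk1 hk3 hk4
    rw [rate_eq]
    set b := scale μ id n
    have hn0 : (0 : ℝ) ≤ n := n.cast_nonneg
    have e0 := mul_le_mul_of_nonneg_left (h0 b hk0) hn0
    have e1 := mul_le_mul_of_nonneg_left (h1 b hk1) hn0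
    have e3 := mul_le_mul_of_nonneg_left (h3 b hk3) hn0
    have e4 := mul_le_mul_of_nonneg_left (h4 b hk4) hn0
    have t0 : n * tailProb μ b ≤ ε := by
      refine le_of_mul_le_mul_left ?_ (by positivity : 0 < b ^ 2)
      calc b ^ 2 * (n * tailProb μ b) = n * (b ^ 2 * tailProb μ b) := by ring
        _ ≤ n * (ε * truncMoment μ id 2 b) := e0
        _ = b ^ 2 * ε := by rw [← hn]; ring
    have t1 : n * b⁻¹ * |truncMoment μ id 1 b| ≤ ε := by
      refine le_of_mul_le_mul_left ?_ (by positivity : 0 < b ^ 2)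
      calc b ^ 2 * (n * b⁻¹ * |truncMoment μ id 1 b|) = n * (|truncMoment μ id 1 b| * b) := by
            field_simp
        _ ≤ n * (ε * truncMoment μ id 2 b) := e1
        _ = b ^ 2 * ε := by rw [← hn]; ring
    have t3 : n * (b ^ 3)⁻¹ * |truncMoment μ id 3 b| ≤ ε := by
      refine le_of_mul_le_mul_left ?_ (by positivity : 0 < b ^ 3)
      calc b ^ 3 * (n * (b ^ 3)⁻¹ * |truncMoment μ id 3 b|) = n * |truncMoment μ id 3 b| := by
            field_simp
        _ ≤ n * (ε * (b * truncMoment μ id 2 b)) := e3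
        _ = b * (n * truncMoment μ id 2 b) * ε := by ring
        _ = b ^ 3 * ε := by rw [hn]; ring
    have t4 : n * (b ^ 4)⁻¹ * truncMoment μ id 4 b ≤ ε := by
      refine le_of_mul_le_mul_left ?_ (by positivity : 0 < b ^ 4)
      calc b ^ 4 * (n * (b ^ 4)⁻¹ * truncMoment μ id 4 b) = n * truncMoment μ id 4 b := by
            field_simp
        _ ≤ n * (ε * (b ^ 2 * truncMoment μ id 2 b)) := e4
        _ = b ^ 2 * (n * truncMoment μ id 2 b) * ε := by ring
        _ = b ^ 4 * ε := by rw [hn]; ring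
    linarith
  have hnn : ∀ᶠ n in atTop, 0 ≤ rate μ id n := by
    filter_upwards [hb.eventually (eventually_gt_atTop 0)] with n hn
    rw [rate_eq]
    have h1 := tailProb_nonneg (μ := μ) (scale μ id n)
    have h2 := truncMoment_nonneg (μ := μ) (by decide : Even 4) (scale μ id n)
    positivity
  rw [Metric.tendsto_nhds]
  intro ε hε
  filter_upwards [key (ε / 8) (by linarith), hnn] with n h1 h2
  rw [Real.dist_eq, sub_zero, abs_of_nonneg h2]
  linarith

end Scale

/-! ### Expansion of the leading term -/

section Expansion

variable {μ : Measure ℝ}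

theorem leadingTerm_eq (n : ℕ) (x : ℝ) :
    leadingTerm μ id n x = n * ∫ y, cdfShift x (y / scale μ id n) ∂μ := rfl

/-- The part of `δ_n / n` that controls the remainder in the expansion of `L_n / n`, at scale `b`. -/
def remainderBound (μ : Measure ℝ) (b : ℝ) : ℝ := truncMoment μ id 4 b / b ^ 4 + tailProb μ b

theorem remainderBound_nonneg {b : ℝ} (hb : 0 < b) : 0 ≤ remainderBound μ b := by
  have h1 := tailProb_nonneg (μ := μ) b
  have h2 := truncMoment_nonneg (μ := μ) (by decide : Even 4) b
  unfold remainderBound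
  positivity

/-- `δ_n / n` at scale `b`. -/
def normalizedRate (μ : Measure ℝ) (b : ℝ) : ℝ :=
  |truncMoment μ id 1 b / b| + |truncMoment μ id 3 b / b ^ 3| + remainderBound μ b

theorem rate_eq_mul {n : ℕ} (hb : 0 < scale μ id n) :
    rate μ id n = n * normalizedRate μ (scale μ id n) := by
  rw [rate_eq, normalizedRate, remainderBound, abs_div, abs_div, abs_of_pos hb,
    abs_of_pos (pow_pos hb 3)]
  ring

variable [IsProbabilityMeasure μ]

theorem integrable_cdfShift (x b : ℝ) : Integrable (fun y => cdfShift x (y / b)) μ := by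
  have := continuous_cdfShift x
  exact Integrable.of_bound (Continuous.aestronglyMeasurable (by fun_prop)) 1
    (Eventually.of_forall fun y => abs_cdfShift_le_one x _)

theorem remainderBound_eq_integral (b : ℝ) : remainderBound μ b =
    ∫ y, ({y : ℝ | |y| ≤ b}.indicator (fun y => y ^ 4) y / b ^ 4
      + {y : ℝ | b < |y|}.indicator (fun _ => (1 : ℝ)) y) ∂μ := by
  rw [integral_add ((integrable_truncated 4 b).div_const _) (integrable_tailIndicator b),
    integral_div, ← truncMoment_id, ← tailProb_eq_integral, remainderBound]

theorem integrable_remainderBound (b : ℝ) :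
    Integrable (fun y => {y : ℝ | |y| ≤ b}.indicator (fun y => y ^ 4) y / b ^ 4
      + {y : ℝ | b < |y|}.indicator (fun _ => (1 : ℝ)) y) μ :=
  ((integrable_truncated 4 b).div_const _).add (integrable_tailIndicator b)

/-- The expansion of `E cdfShift x (X / b)` in truncated moments, uniformly in `x`, `b` and the
law of `X`. -/
theorem exists_abs_integral_cdfShift_le : ∃ C : ℝ, 0 < C ∧ ∀ (μ : Measure ℝ)
    [IsProbabilityMeasure μ] (b x : ℝ), 0 < b →
      |∫ y, cdfShift x (y / b) ∂μ + normalPDF x * (truncMoment μ id 1 b / b)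
        - normalPDF x * (2 * x ^ 2 + 1) / 6 * (truncMoment μ id 3 b / b ^ 3)|
        ≤ C * remainderBound μ b := by
  obtain ⟨C, hC, h⟩ := abs_cdfShift_sub_cubic_le
  refine ⟨max C 1, by positivity, fun μ _ b x hb => ?_⟩
  have hi : Integrable (fun y => cdfShift x (y / b)
      + normalPDF x * ({y : ℝ | |y| ≤ b}.indicator (fun y => y ^ 1) y / b)) μ :=
    (integrable_cdfShift x b).add (((integrable_truncated 1 b).div_const _).const_mul _)
  rw [remainderBound_eq_integral, truncMoment_id, truncMoment_id, ← integral_div, ← integral_div,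
    ← integral_const_mul, ← integral_const_mul, ← integral_const_mul, ← integral_add
      (integrable_cdfShift x b) (((integrable_truncated 1 b).div_const _).const_mul _),
    ← integral_sub hi (((integrable_truncated 3 b).div_const _).const_mul _), ← Real.norm_eq_abs]
  refine norm_integral_le_of_norm_le ((integrable_remainderBound b).const_mul _)
    (Eventually.of_forall fun y => ?_)
  simp only [Set.indicator_apply, Set.mem_ofPred_eq, Real.norm_eq_abs]
  by_cases hy : |y| ≤ b
  · have hu : |y / b| ≤ 1 := by rw [abs_div, abs_of_pos hb]; exact (div_le_one hb).2 hy
    have h1 := h x (y / b) hu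
    simp only [hy, not_lt.2 hy, if_true, if_false, pow_one, add_zero]
    rw [← div_pow, ← div_pow]
    refine h1.trans ?_
    gcongr
    exact le_max_left _ _
  · simp only [hy, not_le.1 hy, if_true, if_false, zero_div, mul_zero, add_zero, sub_zero, zero_add,
      mul_one]
    exact (abs_cdfShift_le_one _ _).trans (le_max_right _ _)

theorem exists_remainderBound_le {x : ℝ} (hx : √3 < x) : ∃ c : ℝ, 0 < c ∧ ∀ (μ : Measure ℝ)
    [IsProbabilityMeasure μ] (b : ℝ), 0 < b →
      c * remainderBound μ b ≤ ∫ y, cdfShift x (y / b) ∂μ - ∫ y, cdfShift (-x) (y / b) ∂μ := by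
  obtain ⟨c, hc, h⟩ := exists_le_cdfShift_sub_neg hx
  refine ⟨c, hc, fun μ _ b hb => ?_⟩
  rw [remainderBound_eq_integral, ← integral_const_mul,
    ← integral_sub (integrable_cdfShift x b) (integrable_cdfShift (-x) b)]
  refine integral_mono ((integrable_remainderBound b).const_mul _)
    ((integrable_cdfShift x b).sub (integrable_cdfShift (-x) b)) fun y => ?_
  refine le_trans (mul_le_mul_of_nonneg_left ?_ hc.le) (h (y / b))
  simp only [Set.indicator_apply, Set.mem_ofPred_eq]
  by_cases hy : |y| ≤ b
  · have hu : |y / b| ≤ 1 := by rw [abs_div, abs_of_pos hb]; exact (div_le_one hb).2 hy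
    simp only [hy, not_lt.2 hy, if_true, if_false, add_zero]
    rw [← div_pow]
    refine le_min ?_ le_rfl
    rw [← Even.pow_abs (by decide)]
    exact pow_le_one₀ (abs_nonneg _) hu
  · have hu : 1 ≤ |y / b| := by
      rw [abs_div, abs_of_pos hb]; exact (one_le_div hb).2 (not_le.1 hy).le
    simp only [hy, not_le.1 hy, if_true, if_false, zero_div, zero_add]
    refine le_min le_rfl ?_
    rw [← Even.pow_abs (by decide)]
    exact one_le_pow₀ hu

theorem exists_abs_integral_cdfShift_le_rate : ∃ C : ℝ, 0 < C ∧ ∀ (μ : Measure ℝ)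
    [IsProbabilityMeasure μ] (b x : ℝ), 0 < b →
      |∫ y, cdfShift x (y / b) ∂μ| ≤ C * normalizedRate μ b := by
  obtain ⟨C, hC, h⟩ := exists_abs_integral_cdfShift_le
  obtain ⟨D, hD, hφ⟩ := exists_normalPDF_mul_sq_le
  refine ⟨C + D, by positivity, fun μ _ b x hb => ?_⟩
  have h1 := h μ b x hb
  obtain ⟨h2, h3⟩ := hφ x
  have hp := (normalPDF_pos x).le
  have hr := remainderBound_nonneg (μ := μ) hb
  unfold normalizedRate
  set I := ∫ y, cdfShift x (y / b) ∂μ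
  set A := truncMoment μ id 1 b / b
  set B := truncMoment μ id 3 b / b ^ 3
  set q := normalPDF x * (2 * x ^ 2 + 1) / 6
  have hq : 0 ≤ q := by positivity
  have hA : |normalPDF x * A| ≤ D * |A| := by rw [abs_mul, abs_of_nonneg hp]; gcongr
  have hB : |q * B| ≤ D * |B| := by rw [abs_mul, abs_of_nonneg hq]; gcongr
  have hA0 := mul_nonneg hC.le (abs_nonneg A)
  have hB0 := mul_nonneg hC.le (abs_nonneg B)
  have hr0 := mul_nonneg hD.le hr
  rw [abs_le] at h1 hA hB ⊢
  constructor <;> linarith [h1.1, h1.2, hA.1, hA.2, hB.1, hB.2]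

/-- The values at `±x₀` bound the remainder; the expansions at `x₀` and `x₁` are then a nonsingular
linear system for the first and third truncated moments. -/
theorem exists_normalizedRate_le {x₀ x₁ : ℝ} (h₀ : √3 < x₀) (h₁ : x₁ ≠ x₀) (h₁' : x₁ ≠ -x₀) :
    ∃ D : ℝ, 0 < D ∧ ∀ (μ : Measure ℝ) [IsProbabilityMeasure μ] (b S : ℝ), 0 < b →
      |∫ y, cdfShift x₀ (y / b) ∂μ| ≤ S → |∫ y, cdfShift (-x₀) (y / b) ∂μ| ≤ S →
      |∫ y, cdfShift x₁ (y / b) ∂μ| ≤ S → normalizedRate μ b ≤ D * S := by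
  obtain ⟨C, hC, hexp⟩ := exists_abs_integral_cdfShift_le
  obtain ⟨c, hc, hlow⟩ := exists_remainderBound_le h₀
  set p₀ := normalPDF x₀ with hp₀
  set p₁ := normalPDF x₁ with hp₁
  have hp₀' : 0 < p₀ := normalPDF_pos _
  have hp₁' : 0 < p₁ := normalPDF_pos _
  set q₀ := (2 * x₀ ^ 2 + 1) / 6 with hq₀
  set q₁ := (2 * x₁ ^ 2 + 1) / 6 with hq₁
  have hq₀' : 0 < q₀ := by positivity
  have hq : 0 < |q₀ - q₁| := by
    rw [abs_pos, hq₀, hq₁]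
    intro h
    have : (x₁ - x₀) * (x₁ + x₀) = 0 := by linarith
    rcases mul_eq_zero.1 this with h | h
    · exact h₁ (by linarith)
    · exact h₁' (by linarith)
  set E := 1 + C * (2 / c) with hE
  have hE0 : 0 < E := by positivity
  set DB := (E / p₀ + E / p₁) / |q₀ - q₁| with hDB
  have hDB0 : 0 < DB := by positivity
  refine ⟨E / p₀ + q₀ * DB + DB + 2 / c, by positivity, fun μ _ b S hb hs₀ hs₀' hs₁ => ?_⟩
  have g := hlow μ b hb
  have e₀ := hexp μ b x₀ hb
  have e₁ := hexp μ b x₁ hb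
  unfold normalizedRate
  set I₀ := ∫ y, cdfShift x₀ (y / b) ∂μ
  set I₁ := ∫ y, cdfShift x₁ (y / b) ∂μ
  set A := truncMoment μ id 1 b / b
  set B := truncMoment μ id 3 b / b ^ 3
  have hr : remainderBound μ b ≤ 2 / c * S := by
    rw [div_mul_eq_mul_div, le_div_iff₀ hc]
    linarith [(abs_le.1 hs₀).2, (abs_le.1 hs₀').1]
  have hCr := mul_le_mul_of_nonneg_left hr hC.le
  have f₀ : |A - q₀ * B| ≤ E / p₀ * S := by
    have : (A - q₀ * B) * p₀
        = (I₀ + p₀ * A - p₀ * (2 * x₀ ^ 2 + 1) / 6 * B) - I₀ := by rw [hq₀]; ring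
    have h : |A - q₀ * B| * p₀ ≤ E * S := by
      rw [← abs_of_pos hp₀', ← abs_mul, this]
      refine (abs_sub _ _).trans ?_
      rw [hE]; linarith
    calc |A - q₀ * B| ≤ E * S / p₀ := (le_div_iff₀ hp₀').2 h
      _ = _ := by ring
  have f₁ : |A - q₁ * B| ≤ E / p₁ * S := by
    have : (A - q₁ * B) * p₁
        = (I₁ + p₁ * A - p₁ * (2 * x₁ ^ 2 + 1) / 6 * B) - I₁ := by rw [hq₁]; ring
    have h : |A - q₁ * B| * p₁ ≤ E * S := by
      rw [← abs_of_pos hp₁', ← abs_mul, this]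
      refine (abs_sub _ _).trans ?_
      rw [hE]; linarith
    calc |A - q₁ * B| ≤ E * S / p₁ := (le_div_iff₀ hp₁').2 h
      _ = _ := by ring
  have hB : |B| ≤ DB * S := by
    rw [hDB, div_mul_eq_mul_div, le_div_iff₀ hq, ← abs_mul]
    have : B * (q₀ - q₁) = (A - q₁ * B) - (A - q₀ * B) := by ring
    rw [this]
    refine (abs_sub _ _).trans ?_
    linarith
  have hA : |A| ≤ E / p₀ * S + q₀ * (DB * S) := by
    have : A = (A - q₀ * B) + q₀ * B := by ring
    rw [this]
    refine (abs_add_le _ _).trans ?_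
    rw [abs_mul q₀ B, abs_of_pos hq₀']
    gcongr
  linarith

/-- The rate does not vanish: `E[X² I(|X| ≤ b)] > 0` forces `E[X⁴ I(|X| ≤ b)] > 0`. -/
theorem truncMoment_four_pos {b : ℝ} (h : 0 < truncMoment μ id 2 b) :
    0 < truncMoment μ id 4 b := by
  set U := truncMoment μ id 2 b with hU
  have h1 : U ≤ U / 2 + truncMoment μ id 4 b / (2 * U) := by
    rw [hU, truncMoment_id 2, truncMoment_id 4, ← truncMoment_id 2, ← hU, ← integral_div]
    have h2 : U / 2 + ∫ y, {y : ℝ | |y| ≤ b}.indicator (fun y => y ^ 4) y / (2 * U) ∂μ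
        = ∫ y, (U / 2 + {y : ℝ | |y| ≤ b}.indicator (fun y => y ^ 4) y / (2 * U)) ∂μ := by
      rw [integral_add (integrable_const _) ((integrable_truncated 4 b).div_const _)]; simp
    rw [h2]
    conv_lhs => rw [hU, truncMoment_id]
    refine integral_mono (integrable_truncated 2 b)
      ((integrable_const _).add ((integrable_truncated 4 b).div_const _)) fun y => ?_
    simp only [Set.indicator_apply, Set.mem_ofPred_eq]
    split_ifs
    · have : U / 2 + y ^ 4 / (2 * U) = (U ^ 2 + y ^ 4) / (2 * U) := by field_simp
      rw [this, le_div_iff₀ (by positivity)]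
      nlinarith [sq_nonneg (U - y ^ 2)]
    · simp only [zero_div, add_zero]; positivity
  have h3 : 0 < truncMoment μ id 4 b / (2 * U) := by linarith
  exact (div_pos_iff_of_pos_right (by positivity)).1 h3

theorem eventually_rate_pos (hint : Integrable id μ) (hnd : ∃ K > 0, 0 < truncMoment μ id 2 K) :
    ∀ᶠ n in atTop, 0 < scale μ id n ∧ 0 < rate μ id n := by
  obtain ⟨hb, heq⟩ := eventually_scale hint hnd
  filter_upwards [hb.eventually (eventually_gt_atTop 0), heq] with n hb0 hn
  refine ⟨hb0, ?_⟩
  have h1 : 0 < n * truncMoment μ id 2 (scale μ id n) := by rw [hn]; positivity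
  have hn0 : (0 : ℝ) < n := pos_of_mul_pos_left h1 (truncMoment_nonneg even_two _)
  have h2 := truncMoment_four_pos (pos_of_mul_pos_right h1 hn0.le)
  have h3 := tailProb_nonneg (μ := μ) (scale μ id n)
  rw [rate_eq]
  positivity

end Expansion

/-! ### Comparison of the suprema with the rate -/

theorem sameOrder_of_le {u v : ℕ → ℝ} {c C : ℝ} (hc : 0 < c) (hv : ∀ᶠ n in atTop, 0 < v n)
    (hlow : ∀ᶠ n in atTop, c * v n ≤ u n) (hupp : ∀ᶠ n in atTop, u n ≤ C * v n) :
    SameOrder u v := by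
  constructor
  · refine lt_of_lt_of_le (EReal.coe_pos.2 hc) (le_liminf_of_le (by isBoundedDefault) ?_)
    filter_upwards [hv, hlow] with n h1 h2
    rw [EReal.coe_le_coe_iff, le_div_iff₀ h1]; exact h2
  · refine lt_of_le_of_lt (limsup_le_of_le (by isBoundedDefault) ?_) (EReal.coe_lt_top C)
    filter_upwards [hv, hupp] with n h1 h2
    rw [EReal.coe_le_coe_iff, div_le_iff₀ h1]; exact h2

section Suprema

variable {μ : Measure ℝ} [IsProbabilityMeasure μ]

theorem abs_leadingTerm_le_sup (n : ℕ) {S : Set ℝ} {x : ℝ} (hx : x ∈ S) :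
    |leadingTerm μ id n x| ≤ supLeadingTerm μ id n S := by
  refine le_csSup ⟨n, ?_⟩ ⟨x, hx, rfl⟩
  rintro _ ⟨z, _, rfl⟩
  exact abs_leadingTerm_le μ id n z

/-- The supremum of `|L_n|` over any set containing `±x₀` and `x₁` has the order of `δ_n`. -/
theorem sameOrder_supLeadingTerm (hint : Integrable id μ)
    (hnd : ∃ K > 0, 0 < truncMoment μ id 2 K) {x₀ x₁ : ℝ} (h₀ : √3 < x₀) (h₁ : x₁ ≠ x₀)
    (h₁' : x₁ ≠ -x₀) {S : Set ℝ} (hS₀ : x₀ ∈ S) (hS₀' : -x₀ ∈ S) (hS₁ : x₁ ∈ S) :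
    SameOrder (fun n => supLeadingTerm μ id n S) (rate μ id) := by
  obtain ⟨C, hC, hup⟩ := exists_abs_integral_cdfShift_le_rate
  obtain ⟨D, hD, hlo⟩ := exists_normalizedRate_le h₀ h₁ h₁'
  have hpos := eventually_rate_pos hint hnd
  refine sameOrder_of_le (c := D⁻¹) (C := C) (inv_pos.2 hD) (hpos.mono fun n h => h.2) ?_ ?_
  · filter_upwards [hpos, eventually_gt_atTop 0] with n ⟨hb, _⟩ hn
    have hn0 : (0 : ℝ) < n := by exact_mod_cast hn
    have key : ∀ x ∈ S, |∫ y, cdfShift x (y / scale μ id n) ∂μ| ≤ supLeadingTerm μ id n S / n := by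
      intro x hx
      have := abs_leadingTerm_le_sup (μ := μ) n hx
      rw [leadingTerm_eq, abs_mul, Nat.abs_cast] at this
      rw [le_div_iff₀ hn0]; linarith
    have h := hlo μ _ _ hb (key _ hS₀) (key _ hS₀') (key _ hS₁)
    rw [rate_eq_mul hb, inv_mul_le_iff₀ hD]
    calc _ ≤ n * (D * (supLeadingTerm μ id n S / n)) := by gcongr
      _ = _ := by field_simp
  · filter_upwards [hpos] with n ⟨hb, _⟩
    refine csSup_le ⟨_, x₀, hS₀, rfl⟩ ?_
    rintro _ ⟨x, _, rfl⟩
    simp only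
    rw [rate_eq_mul hb, leadingTerm_eq, abs_mul, Nat.abs_cast]
    calc _ ≤ n * (C * normalizedRate μ (scale μ id n)) := by gcongr; exact hup μ _ x hb
      _ = _ := by ring

end Suprema

/-! ### The first-order limit under a finite third absolute moment -/

section ThirdMoment

variable {μ : Measure ℝ}

theorem tendsto_thirdMoment_tail (h3 : Integrable (fun y => |y| ^ 3) μ) :
    Tendsto (fun b : ℝ => ∫ y, {y : ℝ | b < |y|}.indicator (fun y => |y| ^ 3) y ∂μ) atTop (𝓝 0) := by
  rw [show (0 : ℝ) = ∫ _, (0 : ℝ) ∂μ by simp]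
  refine tendsto_integral_filter_of_dominated_convergence (fun y => |y| ^ 3)
    (Eventually.of_forall fun x => (h3.indicator (measurableSet_lt_abs x)).aestronglyMeasurable)
    (Eventually.of_forall fun x => Eventually.of_forall fun y => ?_) h3
    (Eventually.of_forall fun y => ?_)
  · simp only [Set.indicator_apply, Set.mem_ofPred_eq]
    split_ifs
    · simp
    · rw [norm_zero]; positivity
  · refine tendsto_const_nhds.congr' ?_
    filter_upwards [eventually_ge_atTop |y|] with x hx
    simp [not_lt.2 hx]

variable [IsProbabilityMeasure μ]

theorem tendsto_truncMoment {k : ℕ} (hk : Integrable (fun y => y ^ k) μ) :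
    Tendsto (truncMoment μ id k) atTop (𝓝 (∫ y, y ^ k ∂μ)) := by
  refine tendsto_integral_filter_of_dominated_convergence (fun y => |y ^ k|)
    (Eventually.of_forall fun x => (integrable_truncated k x).aestronglyMeasurable)
    (Eventually.of_forall fun x => Eventually.of_forall fun y => ?_) hk.abs
    (Eventually.of_forall fun y => ?_)
  · simp only [Set.indicator_apply, Set.mem_ofPred_eq, id]
    split_ifs <;> simp
  · refine tendsto_const_nhds.congr' ?_
    filter_upwards [eventually_ge_atTop |y|] with x hx
    simp [hx]

theorem tendsto_truncMoment_four_div (h3 : Integrable (fun y => |y| ^ 3) μ) :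
    Tendsto (fun b => truncMoment μ id 4 b / b) atTop (𝓝 0) := by
  have h : ∀ b, truncMoment μ id 4 b / b
      = ∫ y, {y : ℝ | |y| ≤ b}.indicator (fun y => y ^ 4) y / b ∂μ := fun b => by
    rw [truncMoment_id, integral_div]
  simp_rw [h]
  rw [show (0 : ℝ) = ∫ _, (0 : ℝ) ∂μ by simp]
  refine tendsto_integral_filter_of_dominated_convergence (fun y => |y| ^ 3)
    (Eventually.of_forall fun b => ((integrable_truncated 4 b).div_const b).aestronglyMeasurable)
    ?_ h3 (Eventually.of_forall fun y => ?_)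
  · filter_upwards [eventually_gt_atTop 0] with b hb
    refine Eventually.of_forall fun y => ?_
    simp only [Set.indicator_apply, Set.mem_ofPred_eq]
    split_ifs with hy
    · rw [Real.norm_eq_abs, abs_div, abs_of_pos hb, div_le_iff₀ hb, abs_pow, pow_succ]
      gcongr
    · simp only [zero_div, norm_zero]; positivity
  · have : Tendsto (fun b : ℝ => y ^ 4 / b) atTop (𝓝 0) := tendsto_const_nhds.div_atTop tendsto_id
    refine this.congr' ?_
    filter_upwards [eventually_ge_atTop |y|] with x hx
    simp [hx]

theorem tendsto_sq_mul_truncMoment_one (hint : Integrable id μ) (hmean : ∫ y, y ∂μ = 0)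
    (h3 : Integrable (fun y => |y| ^ 3) μ) :
    Tendsto (fun b => b ^ 2 * |truncMoment μ id 1 b|) atTop (𝓝 0) := by
  refine tendsto_of_tendsto_of_tendsto_of_le_of_le' tendsto_const_nhds
    (tendsto_thirdMoment_tail h3) (Eventually.of_forall fun b => by positivity) ?_
  filter_upwards [eventually_gt_atTop 0] with b hb
  refine (mul_le_mul_of_nonneg_left (abs_truncMoment_one_le hint hmean b) (sq_nonneg b)).trans ?_
  rw [← integral_const_mul]
  refine integral_mono ((integrable_absTail hint b).const_mul _)
    (h3.indicator (measurableSet_lt_abs b)) fun y => ?_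
  simp only [Set.indicator_apply, Set.mem_ofPred_eq]
  split_ifs with hy
  · rw [pow_succ |y| 2]; gcongr
  · simp

theorem tendsto_cube_mul_tailProb (h3 : Integrable (fun y => |y| ^ 3) μ) :
    Tendsto (fun b => b ^ 3 * tailProb μ b) atTop (𝓝 0) := by
  refine tendsto_of_tendsto_of_tendsto_of_le_of_le' tendsto_const_nhds
    (tendsto_thirdMoment_tail h3) ?_ ?_
  · filter_upwards [eventually_gt_atTop 0] with b hb
    exact mul_nonneg (by positivity) (tailProb_nonneg b)
  · filter_upwards [eventually_gt_atTop 0] with b hb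
    rw [tailProb_eq_integral, ← integral_const_mul]
    refine integral_mono ((integrable_tailIndicator b).const_mul _)
      (h3.indicator (measurableSet_lt_abs b)) fun y => ?_
    simp only [Set.indicator_apply, Set.mem_ofPred_eq]
    split_ifs with hy
    · rw [mul_one]; gcongr
    · simp

/-- With `E X² = 1` the scale is asymptotic to `√n`, so all terms of the expansion can be compared
at the common order `n^{-1/2}`. -/
theorem tendstoUniformly_sqrt_mul_leadingTerm (hint : Integrable id μ) (hmean : ∫ y, y ∂μ = 0)
    (hnd : ∃ K > 0, 0 < truncMoment μ id 2 K) {γ : ℝ} (h3 : Integrable (fun y => |y| ^ 3) μ)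
    (h2 : ∫ y, y ^ 2 ∂μ = 1) (hγ : ∫ y, y ^ 3 ∂μ = γ) :
    TendstoUniformly (fun (n : ℕ) (x : ℝ) => √(n : ℝ) * leadingTerm μ id n x)
      (fun x => γ / 6 * (2 * x ^ 2 + 1) * normalPDF x) atTop := by
  obtain ⟨hb, heq⟩ := eventually_scale hint hnd
  obtain ⟨C, hC, hexp⟩ := exists_abs_integral_cdfShift_le
  obtain ⟨D, hD, hφ⟩ := exists_normalPDF_mul_sq_le
  have hi2 : Integrable (fun y => y ^ 2) μ := by
    by_contra h
    rw [integral_undef h] at h2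
    exact zero_ne_one h2
  have hi3 : Integrable (fun y => y ^ 3) μ := by
    refine (integrable_norm_iff (by fun_prop)).1 ?_
    simpa [abs_pow] using h3
  have hU : Tendsto (fun n => truncMoment μ id 2 (scale μ id n)) atTop (𝓝 1) :=
    h2 ▸ (tendsto_truncMoment hi2).comp hb
  -- `κ n = n^{3/2} / b_n³` tends to `1`
  set κ : ℕ → ℝ := fun n => n * √n / scale μ id n ^ 3 with hκ
  have hκ1 : Tendsto κ atTop (𝓝 1) := by
    have h := ((hU.inv₀ one_ne_zero).sqrt).pow 3
    rw [inv_one, Real.sqrt_one, one_pow] at h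
    refine h.congr' ?_
    filter_upwards [heq, hb.eventually (eventually_gt_atTop 0), eventually_gt_atTop 0]
      with n hn hb0 hn0
    have hn0' : (0 : ℝ) < n := by exact_mod_cast hn0
    have hU' : truncMoment μ id 2 (scale μ id n) = scale μ id n ^ 2 / n := by
      rw [eq_div_iff hn0'.ne', ← hn]; ring
    rw [hU', inv_div, Real.sqrt_div hn0'.le, Real.sqrt_sq hb0.le, div_pow, hκ]
    congr 1
    calc √(n : ℝ) ^ 3 = √(n : ℝ) ^ 2 * √n := by ring
      _ = _ := by rw [Real.sq_sqrt hn0'.le]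
  set e : ℕ → ℝ := fun n =>
    D * (κ n * (scale μ id n ^ 2 * |truncMoment μ id 1 (scale μ id n)|))
    + D * |κ n * truncMoment μ id 3 (scale μ id n) - γ|
    + C * (κ n * (truncMoment μ id 4 (scale μ id n) / scale μ id n)
      + κ n * (scale μ id n ^ 3 * tailProb μ (scale μ id n))) with he
  have he0 : Tendsto e atTop (𝓝 0) := by
    have t1 := ((hκ1.mul ((tendsto_sq_mul_truncMoment_one hint hmean h3).comp hb))).const_mul D
    have t2 := (((hκ1.mul ((tendsto_truncMoment hi3).comp hb)).sub_const γ).abs).const_mul D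
    have t3 := ((hκ1.mul ((tendsto_truncMoment_four_div h3).comp hb)).add
      (hκ1.mul ((tendsto_cube_mul_tailProb h3).comp hb))).const_mul C
    have := (t1.add t2).add t3
    rw [hγ] at this
    simpa using this
  rw [Metric.tendstoUniformly_iff]
  intro ε hε
  filter_upwards [he0.eventually (gt_mem_nhds hε), hb.eventually (eventually_gt_atTop 0)]
    with n hn hb0 x
  refine lt_of_le_of_lt ?_ hn
  have h := hexp μ _ x hb0
  rw [remainderBound] at h
  obtain ⟨hφ1, hφ2⟩ := hφ x
  rw [dist_comm, Real.dist_eq, leadingTerm_eq]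
  simp only [he]
  set b := scale μ id n
  set I := ∫ y, cdfShift x (y / b) ∂μ
  set m1 := truncMoment μ id 1 b
  set m3 := truncMoment μ id 3 b
  set m4 := truncMoment μ id 4 b
  set T := tailProb μ b
  have hp := (normalPDF_pos x).le
  set p := normalPDF x
  set q := p * (2 * x ^ 2 + 1) / 6 with hq
  have hq0 : 0 ≤ q := by positivity
  have hκn : κ n = n * √n / b ^ 3 := rfl
  have hκ0 : 0 ≤ κ n := by positivity
  have hsplit : √(n : ℝ) * (n * I) - γ / 6 * (2 * x ^ 2 + 1) * p
      = n * √n * (I + p * (m1 / b) - q * (m3 / b ^ 3)) - p * (κ n * (b ^ 2 * m1))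
        + q * (κ n * m3 - γ) := by
    rw [hκn, hq]
    field_simp
    ring
  rw [hsplit]
  have s1 : |n * √n * (I + p * (m1 / b) - q * (m3 / b ^ 3))|
      ≤ C * (κ n * (m4 / b) + κ n * (b ^ 3 * T)) := by
    rw [abs_mul, abs_of_nonneg (by positivity : 0 ≤ (n : ℝ) * √n)]
    calc _ ≤ n * √n * (C * (m4 / b ^ 4 + T)) := by gcongr
      _ = _ := by rw [hκn]; field_simp
  have s2 : |p * (κ n * (b ^ 2 * m1))| ≤ D * (κ n * (b ^ 2 * |m1|)) := by
    rw [abs_mul, abs_of_nonneg hp, abs_mul, abs_of_nonneg hκ0, abs_mul, abs_of_nonneg (sq_nonneg b)]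
    gcongr
  have s3 : |q * (κ n * m3 - γ)| ≤ D * |κ n * m3 - γ| := by
    rw [abs_mul, abs_of_nonneg hq0]; gcongr
  refine (abs_add_le _ _).trans ?_
  have := abs_sub (n * √n * (I + p * (m1 / b) - q * (m3 / b ^ 3))) (p * (κ n * (b ^ 2 * m1)))
  linarith

end ThirdMoment

/-! ### Passage from the random variable to its law -/

section Law

variable {Ω : Type*} [MeasurableSpace Ω] {P : Measure Ω} {X : Ω → ℝ} {μ : Measure ℝ}

theorem truncMoment_eq_of_hasLaw (hX : HasLaw X μ P) : truncMoment P X = truncMoment μ id := by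
  funext k x
  have hm : Measurable ({y : ℝ | |y| ≤ x}.indicator fun y => y ^ k) :=
    (measurable_id.pow_const k).indicator (measurableSet_abs_le x)
  exact hX.integral_comp hm.aestronglyMeasurable

theorem scale_eq_of_hasLaw (hX : HasLaw X μ P) : scale P X = scale μ id := by
  funext n
  rw [scale, scale, truncMoment_eq_of_hasLaw hX]

theorem leadingTerm_eq_of_hasLaw (hX : HasLaw X μ P) : leadingTerm P X = leadingTerm μ id := by
  funext n x
  rw [leadingTerm, leadingTerm, scale_eq_of_hasLaw hX]
  congr 1
  have hc := continuous_cdfShift x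
  exact hX.integral_comp (f := fun y => cdfShift x (y / scale μ id n))
    (Continuous.aestronglyMeasurable (by fun_prop))

theorem rate_eq_of_hasLaw (hX : HasLaw X μ P) : rate P X = rate μ id := by
  funext n
  rw [rate, rate, scale_eq_of_hasLaw hX, truncMoment_eq_of_hasLaw hX,
    hX.measureReal_eq (p := fun y => scale μ id n < |y|) (measurableSet_lt_abs _)]
  rfl

theorem supLeadingTerm_eq_of_hasLaw (hX : HasLaw X μ P) :
    supLeadingTerm P X = supLeadingTerm μ id := by
  funext n S
  rw [supLeadingTerm, supLeadingTerm, leadingTerm_eq_of_hasLaw hX]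

end Law

end StudentT

end

theorem theorem2p2 {Ω : Type*} [MeasurableSpace Ω] (P : Measure Ω) [IsProbabilityMeasure P]
    (X : Ω → ℝ) (μ : Measure ℝ) [IsProbabilityMeasure μ] (hX : HasLaw X μ P)
    (hdom : StudentT.InNormalDomainOfAttraction μ)
    (hint : Integrable X P) (hmean : ∫ ω, X ω ∂P = 0) :
    Tendsto (StudentT.rate P X) atTop (𝓝 0) ∧
    StudentT.SameOrder (fun n => StudentT.supLeadingTerm P X n Set.univ) (StudentT.rate P X) ∧
    (∀ x₀ x₁ : ℝ, √3 < x₀ → x₁ ≠ x₀ → x₁ ≠ -x₀ →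
      StudentT.SameOrder (fun n => StudentT.supLeadingTerm P X n {-x₀, x₀, x₁})
        (StudentT.rate P X)) ∧
    (∀ γ : ℝ, Integrable (fun ω => |X ω| ^ 3) P → ∫ ω, X ω ^ 2 ∂P = 1 → ∫ ω, X ω ^ 3 ∂P = γ →
      TendstoUniformly (fun (n : ℕ) (x : ℝ) => √(n : ℝ) * StudentT.leadingTerm P X n x)
        (fun x => γ / 6 * (2 * x ^ 2 + 1) * StudentT.normalPDF x) atTop) := by
  have hint' : Integrable id μ := by
    rw [← hX.map_eq, integrable_map_measure (by fun_prop) hX.aemeasurable]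
    exact hint
  have hpow : ∀ k : ℕ, ∫ ω, X ω ^ k ∂P = ∫ y, y ^ k ∂μ := fun k =>
    hX.integral_comp (f := fun y => y ^ k) (by fun_prop)
  have hmean' : ∫ y, y ∂μ = 0 := by
    have := hpow 1
    simp only [pow_one] at this
    rw [← this, hmean]
  obtain ⟨htail, hnd⟩ := hdom.tailNegligible hint' hmean'
  rw [StudentT.rate_eq_of_hasLaw hX, StudentT.supLeadingTerm_eq_of_hasLaw hX,
    StudentT.leadingTerm_eq_of_hasLaw hX]
  refine ⟨htail.tendsto_rate hint' hmean' hnd, ?_, fun x₀ x₁ h₀ h₁ h₁' => ?_, fun γ h3 h2 hγ => ?_⟩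
  · have h2 : √3 < 2 := by rw [Real.sqrt_lt' two_pos]; norm_num
    exact StudentT.sameOrder_supLeadingTerm hint' hnd (x₁ := 0) h2 (by norm_num) (by norm_num)
      (Set.mem_univ _) (Set.mem_univ _) (Set.mem_univ _)
  · exact StudentT.sameOrder_supLeadingTerm hint' hnd h₀ h₁ h₁' (by simp) (by simp) (by simp)
  · refine StudentT.tendstoUniformly_sqrt_mul_leadingTerm hint' hmean' hnd ?_
      (by rw [← hpow]; exact h2) (by rw [← hpow]; exact hγ)
    rw [← hX.map_eq, integrable_map_measure (by fun_prop) hX.aemeasurable]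
    exact h3
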